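/- Let $\mathbb{K}$ be a field and let $\kappa\in\{0,1\}$. Let $H$ be the 8-dimensional Hopf algebra over $\mathbb{K}$ generated as an algebra by $g$ and $x$ subject to $$g^4=1,\qquad x^2=\kappa(g^2-1),\qquad xg=-gx,$$ with $\Delta(g)=g\otimes g$, $\Delta(x)=x\otimes g+1\otimes x$, $\varepsilon(g)=1$, $\varepsilon(x)=0$, $S(g)=g^3$, $S(x)=-xg^{-1}=g^3x$. The case $\kappa=0$ is called nilpotent and the case $\kappa=1$ non-nilpotent. Let $H_{par}$ be the quotient of the tensor algebra $T(H)$ by the relations $1_H=1_{T(H)}$, $h\otimes k_{(1)}\otimes S(k_{(2)})=hk_{(1)}\otimes S(k_{(2)})$ and $h_{(1)}\otimes S(h_{(2)})\otimes k=h_{(1)}\otimes S(h_{(2)})k$ for all $h,k\in H$. Write $[h]$ for the class of $h\in H$, put $\epsilon_h=[h_{(1)}][S(h_{(2)})]$, and let $A=A_{par}$ be the subalgebra of $H_{par}$ generated by all $\epsilon_h$, $h\in H$. Let $G=\{1,g,g^2,g^3\}$ and, for each of the eight subsets $X\subseteq G$ with $1\in X$, put $$P_X=\prod_{y\in X}\epsilon_y\prod_{y\in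 G\setminus X}(1_A-\epsilon_y)\in A .$$ Then the eight elements $P_X$ are mutually orthogonal central idempotents of $A$ with sum $1_A$, and for all $l\in\{0,1,2,3\}$ (with $\delta$ the Kronecker delta): - $P_{\{1\}}\epsilon_{g^l}=\delta_{l,0}P_{\{1\}}$, $\;P_{\{1\}}\epsilon_{g^lx}=(\delta_{l,0}+\delta_{l,3})P_{\{1\}}\epsilon_x$, $\;P_{\{1\}}\epsilon_x^2=-\kappa P_{\{1\}}$; - $P_{\{1,g\}}\epsilon_{g^l}=(\delta_{l,0}+\delta_{l,1})P_{\{1,g\}}$, $\;P_{\{1,g\}}\epsilon_{g^lx}=(\delta_{l,1}-\delta_{l,3})P_{\{1,g\}}\epsilon_{gx}$, $\;P_{\{1,g\}}\epsilon_{gx}^2=-\kappa P_{\{1,g\}}$; - $P_{\{1,g^3\}}\epsilon_{g^l}=(\delta_{l,0}+\delta_{l,3})P_{\{1,g^3\}}$, $\;P_{\{1,g^3\}}\epsilon_{g^lx}=(\delta_{l,0}-\delta_{l,2})P_{\{1,g^3\}}\epsilon_x$, $\;P_{\{1,g^3\}}\epsilon_x^2=-\kappa P_{\{1,g^3\}}$;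 - $P_{\{1,g^2\}}\epsilon_{g^l}=(\delta_{l,0}+\delta_{l,2})P_{\{1,g^2\}}$, $\;P_{\{1,g^2\}}\epsilon_{g^lx}=P_{\{1,g^2\}}\epsilon_x$; - $P_{\{1,g,g^2\}}\epsilon_{g^l}=(\delta_{l,0}+\delta_{l,1}+\delta_{l,2})P_{\{1,g,g^2\}}$, $\;P_{\{1,g,g^2\}}\epsilon_{g^lx}=(\delta_{l,2}+\delta_{l,3})P_{\{1,g,g^2\}}\epsilon_{g^2x}$, $\;P_{\{1,g,g^2\}}\epsilon_{g^2x}^2=-\kappa P_{\{1,g,g^2\}}$; - $P_{\{1,g,g^3\}}\epsilon_{g^l}=(\delta_{l,0}+\delta_{l,1}+\delta_{l,3})P_{\{1,g,g^3\}}$, $\;P_{\{1,g,g^3\}}\epsilon_{g^lx}=(\delta_{l,1}+\delta_{l,2})P_{\{1,g,g^3\}}\epsilon_{gx}$, $\;P_{\{1,g,g^3\}}\epsilon_{gx}^2=-\kappa P_{\{1,g,g^3\}}$; - $P_{\{1,g^2,g^3\}}\epsilon_{g^l}=(\delta_{l,0}+\delta_{l,2}+\delta_{l,3})P_{\{1,g^2,g^3\}}$,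 $\;P_{\{1,g^2,g^3\}}\epsilon_{g^lx}=(\delta_{l,0}+\delta_{l,1})P_{\{1,g^2,g^3\}}\epsilon_x$, $\;P_{\{1,g^2,g^3\}}\epsilon_x^2=-\kappa P_{\{1,g^2,g^3\}}$; - $P_G\epsilon_{g^l}=P_G$, $\;P_G\epsilon_{g^lx}=0$. Moreover there are isomorphisms of unital $\mathbb{K}$-algebras (where $P_YA$ has unit $P_Y$ and $X$ now denotes a polynomial variable) $$P_YA\simeq\mathbb{K}[X]/\langle X^2\rangle\ \text{ if }\kappa=0,\qquad P_YA\simeq\mathbb{K}[X]/\langle X^2+1\rangle\ \text{ if }\kappa=1,$$ for $Y=\{1\},\{1,g\},\{1,g^3\},\{1,g,g^2\},\{1,g,g^3\},\{1,g^2,g^3\}$, which can be chosen so that the class of $X$ corresponds to $P_Y\epsilon_x$, $P_Y\epsilon_{gx}$, $P_Y\epsilon_x$, $P_Y\epsilon_{g^2x}$, $P_Y\epsilon_{gx}$, $P_Y\epsilon_x$ respectively; $P_{\{1,g^2\}}A\simeq\mathbb{K}[X]$ with $X$ corresponding to $P_{\{1,g^2\}}\epsilon_x$; and $P_GA\simeq\mathbb{K}$.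 -/

import Mathlib

open scoped TensorProduct Polynomial

noncomputable section

/-! ### The partial Hopf algebra of a Hopf algebra and its base algebra -/

section PartialHopf

variable (K : Type*) [Field K] (H : Type*) [Ring H] [HopfAlgebra K H]

/-- For linear maps `f₁ f₂ : H → B` into an algebra, the linear map
`H ⊗ H → B`, `a ⊗ b ↦ f₁ a * f₂ b`. -/
def mulTensor {K : Type*} [Field K] {H : Type*} [AddCommGroup H] [Module K H]
    {B : Type*} [Ring B] [Algebra K B] (f₁ f₂ : H →ₗ[K] B) : H ⊗[K] H →ₗ[K] B :=
  LinearMap.mul' K B ∘ₗ TensorProduct.map f₁ f₂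

/-- The defining relations of `H_par` on the tensor algebra `T(H)`, where
`Δ k = ∑ k₁ ⊗ k₂`:
* `1_H = 1_{T(H)}`,
* `h ⊗ k₁ ⊗ S(k₂) = h k₁ ⊗ S(k₂)`,
* `h₁ ⊗ S(h₂) ⊗ k = h₁ ⊗ S(h₂) k`. -/
inductive HparRel : TensorAlgebra K H → TensorAlgebra K H → Prop
  | one : HparRel (TensorAlgebra.ι K (1 : H)) 1
  | left (h k : H) : HparRel
      (TensorAlgebra.ι K h *
        mulTensor (TensorAlgebra.ι K) (TensorAlgebra.ι K ∘ₗ HopfAlgebra.antipode K)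
          (Coalgebra.comul (R := K) k))
      (mulTensor (TensorAlgebra.ι K ∘ₗ LinearMap.mulLeft K h)
        (TensorAlgebra.ι K ∘ₗ HopfAlgebra.antipode K) (Coalgebra.comul (R := K) k))
  | right (h k : H) : HparRel
      (mulTensor (TensorAlgebra.ι K) (TensorAlgebra.ι K ∘ₗ HopfAlgebra.antipode K)
          (Coalgebra.comul (R := K) h) * TensorAlgebra.ι K k)
      (mulTensor (TensorAlgebra.ι K)
        (TensorAlgebra.ι K ∘ₗ LinearMap.mulRight K k ∘ₗ HopfAlgebra.antipode K)
        (Coalgebra.comul (R := K) h))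

/-- The partial Hopf algebra `H_par`. -/
def Hpar : Type _ := RingQuot (HparRel K H)

instance : Ring (Hpar K H) := inferInstanceAs (Ring (RingQuot (HparRel K H)))

instance : Algebra K (Hpar K H) := inferInstanceAs (Algebra K (RingQuot (HparRel K H)))

/-- The canonical linear map `h ↦ [h]` from `H` to `H_par`. -/
def Hpar.bracket : H →ₗ[K] Hpar K H :=
  (RingQuot.mkAlgHom K (HparRel K H)).toLinearMap ∘ₗ TensorAlgebra.ι K

/-- The linear map `h ↦ ε_h = [h₁] [S(h₂)]` from `H` to `H_par`. -/
def Hpar.eps : H →ₗ[K] Hpar K H :=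
  mulTensor (Hpar.bracket K H) (Hpar.bracket K H ∘ₗ HopfAlgebra.antipode K) ∘ₗ
    Coalgebra.comul

/-- The base algebra `A_par`: the subalgebra of `H_par` generated by the `ε_h`, `h ∈ H`. -/
def Apar : Subalgebra K (Hpar K H) := Algebra.adjoin K (Set.range (Hpar.eps K H))

/-- The element `ε_h` of `A_par`. -/
def Apar.eps (h : H) : Apar K H :=
  ⟨Hpar.eps K H h, Algebra.subset_adjoin ⟨h, rfl⟩⟩

end PartialHopf

/-! ### Corners as algebras -/

section Corner

variable {K : Type*} [Field K] {A : Type*} [Ring A] [Algebra K A] {e : A}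

/-- For an idempotent `e` of a `K`-algebra `A`, the corner `e A e` (which is `e A` when `e` is
central) is a `K`-algebra with unit `e`, with the scalar multiplication inherited from `A`. -/
instance cornerAlgebra (he : IsIdempotentElem e) : Algebra K he.Corner where
  smul c a := ⟨c • a.1, by
    obtain ⟨b, hb⟩ := a.2
    exact ⟨c • b, by
      change e * (c • b) * e = c • a.1
      rw [← hb, mul_smul_comm, smul_mul_assoc]⟩⟩
  algebraMap :=
    { toFun := fun c => ⟨c • e, c • 1, by
        change e * (c • 1) * e = c • e
        rw [mul_smul_comm, smul_mul_assoc, mul_one, he.eq]⟩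
      map_one' := Subtype.ext (one_smul K e)
      map_mul' := fun a b => Subtype.ext (by
        change (a * b) • e = (a • e) * (b • e)
        rw [smul_mul_smul_comm, he.eq])
      map_zero' := Subtype.ext (zero_smul K e)
      map_add' := fun a b => Subtype.ext (add_smul a b e) }
  commutes' c a := Subtype.ext (by
    change (c • e) * a.1 = a.1 * (c • e)
    have h := (Subsemigroup.mem_corner_iff he).mp a.2
    rw [smul_mul_assoc, mul_smul_comm, h.1, h.2])
  smul_def' c a := Subtype.ext (by
    change c • a.1 = (c • e) * a.1
    have h := (Subsemigroup.mem_corner_iff he).mp a.2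
    rw [smul_mul_assoc, h.1])

end Corner

/-! ### The two Hopf algebras of rank one -/

namespace RankOne

/-- The two generators. -/
inductive Gen
  | g
  | x

variable {K : Type*} [Field K]

/-- The relations `g⁴ = 1`, `x² = κ (g² - 1)`, `x g = - g x`. -/
inductive Rel (κ : K) : FreeAlgebra K Gen → FreeAlgebra K Gen → Prop
  | g_pow : Rel κ (FreeAlgebra.ι K Gen.g ^ 4) 1
  | x_sq : Rel κ (FreeAlgebra.ι K Gen.x ^ 2) (κ • (FreeAlgebra.ι K Gen.g ^ 2 - 1))
  | x_mul_g : Rel κ (FreeAlgebra.ι K Gen.x * FreeAlgebra.ι K Gen.g)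
      (-(FreeAlgebra.ι K Gen.g * FreeAlgebra.ι K Gen.x))

/-- The algebra generated by `g` and `x` subject to the relations
`g⁴ = 1`, `x² = κ (g² - 1)`, `x g = - g x`. -/
def H (κ : K) : Type _ := RingQuot (Rel κ)

instance (κ : K) : Ring (H κ) := inferInstanceAs (Ring (RingQuot (Rel κ)))

instance (κ : K) : Algebra K (H κ) := inferInstanceAs (Algebra K (RingQuot (Rel κ)))

/-- The image in `H κ` of a generator. -/
def gen (κ : K) (i : Gen) : H κ := RingQuot.mkAlgHom K (Rel κ) (FreeAlgebra.ι K i)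

/-- The generator `g`. -/
def g (κ : K) : H κ := gen κ Gen.g

/-- The generator `x`. -/
def x (κ : K) : H κ := gen κ Gen.x

theorem g_pow_four (κ : K) : g κ ^ 4 = 1 := by
  have h := RingQuot.mkAlgHom_rel K (Rel.g_pow (κ := κ))
  rw [map_pow, map_one] at h
  exact h

theorem x_sq (κ : K) : x κ ^ 2 = κ • (g κ ^ 2 - 1) := by
  have h := RingQuot.mkAlgHom_rel K (Rel.x_sq (κ := κ))
  rw [map_pow, map_smul, map_sub, map_pow, map_one] at h
  exact h

theorem x_mul_g (κ : K) : x κ * g κ = -(g κ * x κ) := by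
  have h := RingQuot.mkAlgHom_rel K (Rel.x_mul_g (κ := κ))
  rw [map_mul, map_neg, map_mul] at h
  exact h

/-- The universal property of `H κ`. -/
def lift (κ : K) {B : Type*} [Ring B] [Algebra K B] (a b : B) (h₁ : a ^ 4 = 1)
    (h₂ : b ^ 2 = κ • (a ^ 2 - 1)) (h₃ : b * a = -(a * b)) : H κ →ₐ[K] B :=
  RingQuot.liftAlgHom K ⟨FreeAlgebra.lift K (fun i => Gen.casesOn i a b), by
    intro u v huv
    cases huv <;> simp [h₁, h₂, h₃]⟩

section lift

variable (κ : K) {B : Type*} [Ring B] [Algebra K B] (a b : B) (h₁ : a ^ 4 = 1)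
    (h₂ : b ^ 2 = κ • (a ^ 2 - 1)) (h₃ : b * a = -(a * b))

@[simp] theorem lift_g : lift κ a b h₁ h₂ h₃ (g κ) = a := by
  unfold lift g gen
  erw [RingQuot.liftAlgHom_mkAlgHom_apply]
  simp

@[simp] theorem lift_x : lift κ a b h₁ h₂ h₃ (x κ) = b := by
  unfold lift x gen
  erw [RingQuot.liftAlgHom_mkAlgHom_apply]
  simp

end lift

theorem induction (κ : K) {p : H κ → Prop} (hc : ∀ c : K, p (algebraMap K (H κ) c))
    (hg : p (g κ)) (hx : p (x κ)) (hmul : ∀ a b, p a → p b → p (a * b))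
    (hadd : ∀ a b, p a → p b → p (a + b)) (a : H κ) : p a := by
  obtain ⟨u, rfl⟩ := RingQuot.mkAlgHom_surjective K (Rel κ) a
  induction u using FreeAlgebra.induction with
  | grade0 r => rw [AlgHom.commutes]; exact hc r
  | grade1 i => cases i <;> assumption
  | mul a b ha hb => rw [map_mul]; exact hmul _ _ ha hb
  | add a b ha hb => rw [map_add]; exact hadd _ _ ha hb

theorem algHom_ext (κ : K) {B : Type*} [Ring B] [Algebra K B] {φ ψ : H κ →ₐ[K] B}
    (hg : φ (g κ) = ψ (g κ)) (hx : φ (x κ) = ψ (x κ)) : φ = ψ := by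
  ext a
  induction a using induction with
  | hc c => simp
  | hg => exact hg
  | hx => exact hx
  | hmul a b ha hb => simp [ha, hb]
  | hadd a b ha hb => simp [ha, hb]

/-- The comultiplication: `Δ g = g ⊗ g`, `Δ x = x ⊗ g + 1 ⊗ x`. -/
def comulHom (κ : K) : H κ →ₐ[K] H κ ⊗[K] H κ :=
  lift κ (g κ ⊗ₜ g κ) (x κ ⊗ₜ g κ + 1 ⊗ₜ x κ)
    (by rw [Algebra.TensorProduct.tmul_pow, g_pow_four, Algebra.TensorProduct.one_def])
    (by
      simp only [pow_two, mul_add, add_mul, Algebra.TensorProduct.tmul_mul_tmul, one_mul, mul_one]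
      rw [← pow_two (x κ), ← pow_two (g κ), x_sq, x_mul_g, TensorProduct.tmul_neg,
        Algebra.TensorProduct.one_def, ← TensorProduct.smul_tmul', TensorProduct.tmul_smul,
        TensorProduct.sub_tmul, TensorProduct.tmul_sub, smul_sub, smul_sub, smul_sub]
      abel)
    (by
      simp only [mul_add, add_mul, Algebra.TensorProduct.tmul_mul_tmul, one_mul, mul_one]
      rw [x_mul_g, TensorProduct.tmul_neg, TensorProduct.neg_tmul]
      abel)

/-- The counit: `g ↦ 1`, `x ↦ 0`. -/
def counitHom (κ : K) : H κ →ₐ[K] K := lift κ 1 0 (by simp) (by simp) (by simp)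

instance (κ : K) : Bialgebra K (H κ) :=
  Bialgebra.ofAlgHom (comulHom κ) (counitHom κ)
    (by
      apply algHom_ext
      · simp [comulHom]
      · simp [comulHom, TensorProduct.tmul_add, TensorProduct.add_tmul, add_assoc,
          Algebra.TensorProduct.one_def])
    (by
      apply algHom_ext
      · simp [comulHom, counitHom]
      · simp [comulHom, counitHom])
    (by
      apply algHom_ext
      · simp [comulHom, counitHom]
      · simp [comulHom, counitHom])

theorem comul_g (κ : K) : Coalgebra.comul (R := K) (g κ) = g κ ⊗ₜ g κ :=
  lift_g ..

theorem comul_x (κ : K) : Coalgebra.comul (R := K) (x κ) = x κ ⊗ₜ g κ + 1 ⊗ₜ x κ :=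
  lift_x ..

theorem counit_g (κ : K) : Coalgebra.counit (R := K) (g κ) = 1 :=
  lift_g ..

theorem counit_x (κ : K) : Coalgebra.counit (R := K) (x κ) = 0 :=
  lift_x ..

theorem x_mul_g_pow_three (κ : K) : x κ * g κ ^ 3 = -(g κ ^ 3 * x κ) := by
  have h2 : x κ * g κ ^ 2 = g κ ^ 2 * x κ := by
    rw [pow_two, ← mul_assoc, x_mul_g, neg_mul, mul_assoc, x_mul_g, mul_neg, neg_neg, mul_assoc]
  rw [pow_succ, ← mul_assoc, h2, mul_assoc, x_mul_g, mul_neg, mul_assoc]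

/-- The antipode as an algebra map to the opposite algebra: `S(g) = g³`, `S(x) = g³ x`. -/
def antipodeHom (κ : K) : H κ →ₐ[K] (H κ)ᵐᵒᵖ :=
  lift κ (MulOpposite.op (g κ ^ 3)) (MulOpposite.op (g κ ^ 3 * x κ))
    (by
      rw [← MulOpposite.op_pow, ← pow_mul, show 3 * 4 = 4 * 3 from rfl, pow_mul, g_pow_four,
        one_pow, MulOpposite.op_one])
    (by
      have h6 : g κ ^ 3 * g κ ^ 3 = g κ ^ 2 := by
        rw [← pow_add, show 3 + 3 = 4 + 2 from rfl, pow_add, g_pow_four, one_mul]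
      have h : (g κ ^ 3 * x κ) ^ 2 = κ • ((g κ ^ 3) ^ 2 - 1) := by
        have h4 : g κ ^ 2 * g κ ^ 2 = 1 := by rw [← pow_add, g_pow_four]
        calc (g κ ^ 3 * x κ) ^ 2 = g κ ^ 3 * (x κ * g κ ^ 3) * x κ := by
              rw [pow_two]; simp only [mul_assoc]
          _ = -(g κ ^ 3 * g κ ^ 3 * (x κ ^ 2)) := by
              rw [x_mul_g_pow_three, pow_two (x κ)]; simp only [mul_neg, neg_mul, mul_assoc]
          _ = κ • ((g κ ^ 3) ^ 2 - 1) := by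
              rw [h6, x_sq, pow_two (g κ ^ 3), h6, mul_smul_comm, mul_sub, h4, mul_one,
                ← smul_neg, neg_sub]
      rw [← MulOpposite.op_pow, h, MulOpposite.op_smul, MulOpposite.op_sub, MulOpposite.op_pow,
        MulOpposite.op_one])
    (by
      rw [← MulOpposite.op_mul, ← MulOpposite.op_mul, ← MulOpposite.op_neg]
      congr 1
      rw [mul_assoc, x_mul_g_pow_three, mul_neg, neg_neg])

/-- The antipode as a linear map. -/
def antipodeLin (κ : K) : H κ →ₗ[K] H κ :=
  (MulOpposite.opLinearEquiv K).symm.toLinearMap ∘ₗ (antipodeHom κ).toLinearMap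

theorem antipodeLin_g (κ : K) : antipodeLin κ (g κ) = g κ ^ 3 := by
  simp [antipodeLin, antipodeHom]

theorem antipodeLin_x (κ : K) : antipodeLin κ (x κ) = g κ ^ 3 * x κ := by
  simp [antipodeLin, antipodeHom]

theorem antipodeLin_one (κ : K) : antipodeLin κ 1 = 1 := by
  simp [antipodeLin]

theorem antipodeLin_mul (κ : K) (a b : H κ) :
    antipodeLin κ (a * b) = antipodeLin κ b * antipodeLin κ a := by
  simp [antipodeLin]

theorem antipode_left (κ : K) (a : H κ) :
    LinearMap.mul' K (H κ) ((antipodeLin κ).rTensor (H κ) (Coalgebra.comul a)) =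
      algebraMap K (H κ) (Coalgebra.counit a) := by
  have key : ∀ s t : H κ ⊗[K] H κ, ∀ c : K,
      LinearMap.mul' K (H κ) ((antipodeLin κ).rTensor (H κ) s) = algebraMap K (H κ) c →
      LinearMap.mul' K (H κ) ((antipodeLin κ).rTensor (H κ) (s * t)) =
        algebraMap K (H κ) c *
          LinearMap.mul' K (H κ) ((antipodeLin κ).rTensor (H κ) t) := by
    intro s t c hs
    have aux : ∀ p q : H κ,
        LinearMap.mul' K (H κ) ((antipodeLin κ).rTensor (H κ) (s * p ⊗ₜ q)) =
          antipodeLin κ p * LinearMap.mul' K (H κ) ((antipodeLin κ).rTensor (H κ) s) * q := by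
      intro p q
      clear hs
      induction s with
      | zero => simp
      | tmul u v => simp [antipodeLin_mul, mul_assoc]
      | add u v hu hv => simp only [add_mul, mul_add, map_add, hu, hv]
    induction t with
    | zero => simp
    | tmul p q =>
      rw [aux, hs, ← Algebra.commutes]
      simp [mul_assoc]
    | add u v hu hv => simp only [mul_add, map_add, hu, hv]
  induction a using induction with
  | hc c =>
    rw [Bialgebra.comul_algebraMap, Bialgebra.counit_algebraMap,
      Algebra.TensorProduct.algebraMap_apply]
    simp [Algebra.algebraMap_eq_smul_one, antipodeLin_one]
  | hg =>
    rw [comul_g, counit_g]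
    simp [antipodeLin_g, ← pow_succ, g_pow_four]
  | hx =>
    rw [comul_x, counit_x]
    simp only [map_add, LinearMap.rTensor_tmul, LinearMap.mul'_apply, antipodeLin_x,
      antipodeLin_one, map_zero, one_mul]
    rw [mul_assoc, x_mul_g, mul_neg, ← mul_assoc, ← pow_succ, g_pow_four, one_mul,
      neg_add_cancel]
  | hmul a b ha hb =>
    rw [Bialgebra.comul_mul, Bialgebra.counit_mul, map_mul (algebraMap K (H κ)),
      key _ _ _ ha, hb]
  | hadd a b ha hb => simp only [map_add, ha, hb]

theorem antipode_right (κ : K) (a : H κ) :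
    LinearMap.mul' K (H κ) ((antipodeLin κ).lTensor (H κ) (Coalgebra.comul a)) =
      algebraMap K (H κ) (Coalgebra.counit a) := by
  have key : ∀ s t : H κ ⊗[K] H κ, ∀ c : K,
      LinearMap.mul' K (H κ) ((antipodeLin κ).lTensor (H κ) t) = algebraMap K (H κ) c →
      LinearMap.mul' K (H κ) ((antipodeLin κ).lTensor (H κ) (s * t)) =
        LinearMap.mul' K (H κ) ((antipodeLin κ).lTensor (H κ) s) * algebraMap K (H κ) c := by
    intro s t c ht
    have aux : ∀ p q : H κ,
        LinearMap.mul' K (H κ) ((antipodeLin κ).lTensor (H κ) (p ⊗ₜ q * t)) =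
          p * LinearMap.mul' K (H κ) ((antipodeLin κ).lTensor (H κ) t) * antipodeLin κ q := by
      intro p q
      clear ht
      induction t with
      | zero => simp
      | tmul u v => simp [antipodeLin_mul, mul_assoc]
      | add u v hu hv => simp only [add_mul, mul_add, map_add, hu, hv]
    induction s with
    | zero => simp
    | tmul p q =>
      rw [aux, ht, mul_assoc, Algebra.commutes]
      simp [mul_assoc]
    | add u v hu hv => simp only [add_mul, map_add, hu, hv]
  induction a using induction with
  | hc c =>
    rw [Bialgebra.comul_algebraMap, Bialgebra.counit_algebraMap,
      Algebra.TensorProduct.algebraMap_apply]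
    simp [Algebra.algebraMap_eq_smul_one, antipodeLin_one]
  | hg =>
    rw [comul_g, counit_g]
    simp [antipodeLin_g, ← pow_succ', g_pow_four]
  | hx =>
    rw [comul_x, counit_x]
    simp only [map_add, LinearMap.lTensor_tmul, LinearMap.mul'_apply, antipodeLin_x,
      antipodeLin_g, map_zero, one_mul]
    rw [x_mul_g_pow_three, neg_add_cancel]
  | hmul a b ha hb =>
    rw [Bialgebra.comul_mul, Bialgebra.counit_mul, map_mul (algebraMap K (H κ)),
      key _ _ _ hb, ha]
  | hadd a b ha hb => simp only [map_add, ha, hb]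

/-- The Hopf algebra generated by `g` and `x` with `g⁴ = 1`, `x² = κ (g² - 1)`, `x g = - g x`,
`Δ g = g ⊗ g`, `Δ x = x ⊗ g + 1 ⊗ x`, `ε(g) = 1`, `ε(x) = 0`, `S(g) = g³`, `S(x) = g³ x`
(so `S(x) = - x g⁻¹`). -/
instance (κ : K) : HopfAlgebra K (H κ) where
  antipode := antipodeLin κ
  mul_antipode_rTensor_comul := LinearMap.ext (antipode_left κ)
  mul_antipode_lTensor_comul := LinearMap.ext (antipode_right κ)

/-- The base algebra `A_par` of `H κ`. -/
abbrev A (κ : K) : Type _ := Apar K (H κ)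

/-- The element `ε_{gˡ}` of `A_par`. -/
def epsG (κ : K) (l : Fin 4) : A κ := Apar.eps K (H κ) (g κ ^ (l : ℕ))

/-- The element `ε_{gˡ x}` of `A_par`. -/
def epsX (κ : K) (l : Fin 4) : A κ := Apar.eps K (H κ) (g κ ^ (l : ℕ) * x κ)

/-- A subset `X` of the group `G = {1, g, g², g³}` is given by the set of exponents of its
elements. The element `P_X` is the product of the `ε_y` with `y ∈ X` and the `1 - ε_y` with
`y ∈ G \ X`, here taken in increasing order of the exponents. -/
def P (κ : K) (X : Finset (Fin 4)) : A κ :=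
  (((List.finRange 4).filter (fun l => l ∈ X)).map (fun l => epsG κ l)).prod *
    (((List.finRange 4).filter (fun l => l ∉ X)).map (fun l => 1 - epsG κ l)).prod

/-- The set `𝒫₁(G)` of the subsets of `G` that contain `1`. -/
abbrev P₁ : Type := {X : Finset (Fin 4) // 0 ∈ X}

/-- The Kronecker delta with values in `K`. -/
def δ (K : Type*) [Field K] (i j : Fin 4) : K := if i = j then 1 else 0

end RankOne

end

open RankOne (A epsG epsX P P₁ δ)

/-!
Write `a_l` for `ε_{gˡ}` and `y_l` for `ε_{gˡ x}`, with `l` modulo `4`, so that `A` is generated by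
the `a_l` and the `y_l`.

*Relations.* In `H_par`, the elements `ε_h` satisfy `ε_h = ε_{h₁} ε_{h₂}` and
`ε_{h₁} ε_{h₂ k} = ε_{h₁ k} ε_{h₂}`, because both sides of the latter are equal to
`[h₁] ε_k [S(h₂)]`. Only group-like and skew primitive elements `h` are needed
(`Hpar.commute_eps_eps_mul`, `Hpar.eps_skewPrimitive_comm`, `Hpar.eps_skewPrimitive_idem`). For
`h = gˡ` this says that the `a_l` are central idempotents, so that the `P_X` are a complete family of
orthogonal central idempotents. Let `χ` be the indicator function of `X` and
`d_l = χ(l + 1) - χ(l)`. For `h = gˡ x`, multiplication by `P_X` turns the relations into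
* `(1 - χ(l) - χ(l + 1)) P_X y_l = 0`,
* `d_{l + m} P_X y_l = (-1)ᵐ d_l P_X y_{l + m}`,
* `P_X (y_l y_{l + 1 + m} - y_{l + m} y_l) = (-1)ᵐ κ d_l (χ(l + m + 2) - χ(l + m)) P_X`.

Hence if `d_l ≠ 0` for some `l`, then all the `P_X y_m` are explicit multiples of `P_X y_l`
(`RankOne.P_mul_epsX`), and `P_X y_l² = -κ P_X` unless `χ` has period `2` (`RankOne.P_mul_epsX_sq`).
If `X = G`, then all the `P_X y_l` vanish. So each `P_X A` is a quotient of the algebra in question.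

*Independence.* To see that the quotient is not a proper one, algebra maps from `A` to commutative
algebras `B` are constructed in `RankOne.exists_algHom`. Let `T` be an idempotent in an algebra `E`
with an algebra map `ρ : H → E`. If `T` commutes with all the `ρ(h₁) T ρ(S(h₂))`, then
`h ↦ T ρ(h) T` extends to an algebra map from `H_par` to `T E T` (`partialRep`), which sends `ε_h`
to `T ρ(h₁) T ρ(S(h₂))`. This is applied to the action of `H` on the linear maps `φ : H → B` by
`(h · φ)(k) = φ(k h)`, where `T` is multiplication by an idempotent `ω` of the convolution algebra;
then `ρ(h₁) T ρ(S(h₂))` is multiplication by `h · ω`, and evaluation at `1 ∈ H` gives an algebra map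
`A → B` with `ε_h ↦ ω(h)`. The idempotents needed are `ω(gˡ) = χ(l)`,
`ω(gˡ x) = (-1)ˡ (χ(l + 1) - χ(l)) z`, with `(z² + κ) (χ(l + 2) - χ(l)) = 0` for all `l`; so `z` may
be, up to sign, the class of the variable in `K[X] / (X² + κ)`, or the variable of `K[X]` itself if
`χ` has period `2`.
-/

/-! ### Relations in the partial Hopf algebra -/

section PartialHopfRelations

variable {K : Type*} [Field K] {H : Type*} [Ring H] [HopfAlgebra K H]

@[simp] theorem mulTensor_tmul {H : Type*} [AddCommGroup H] [Module K H]
    {B : Type*} [Ring B] [Algebra K B] (f₁ f₂ : H →ₗ[K] B) (a b : H) :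
    mulTensor f₁ f₂ (a ⊗ₜ b) = f₁ a * f₂ b := rfl

theorem map_mulTensor {H : Type*} [AddCommGroup H] [Module K H]
    {B C : Type*} [Ring B] [Algebra K B] [Ring C] [Algebra K C] (φ : B →ₐ[K] C)
    (f₁ f₂ : H →ₗ[K] B) (t : H ⊗[K] H) :
    φ (mulTensor f₁ f₂ t) = mulTensor (φ.toLinearMap ∘ₗ f₁) (φ.toLinearMap ∘ₗ f₂) t := by
  induction t with
  | zero => simp
  | tmul a b => simp
  | add s t hs ht => simp only [map_add, hs, ht]

namespace Hpar

theorem bracket_one : bracket K H 1 = 1 := by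
  exact (RingQuot.mkAlgHom_rel K (HparRel.one (K := K) (H := H))).trans (map_one _)

/-- The relation `[h] [k₁] [S(k₂)] = [h k₁] [S(k₂)]` of `H_par`. -/
theorem bracket_mul_eps (h k : H) : bracket K H h * eps K H k =
    mulTensor (bracket K H ∘ₗ LinearMap.mulLeft K h) (bracket K H ∘ₗ HopfAlgebra.antipode K)
      (Coalgebra.comul (R := K) k) := by
  have := RingQuot.mkAlgHom_rel K (HparRel.left (K := K) h k)
  rw [map_mul, map_mulTensor, map_mulTensor] at this
  exact this

/-- The relation `[h₁] [S(h₂)] [k] = [h₁] [S(h₂) k]` of `H_par`. -/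
theorem eps_mul_bracket (h k : H) : eps K H h * bracket K H k =
    mulTensor (bracket K H) (bracket K H ∘ₗ LinearMap.mulRight K k ∘ₗ HopfAlgebra.antipode K)
      (Coalgebra.comul (R := K) h) := by
  have := RingQuot.mkAlgHom_rel K (HparRel.right (K := K) h k)
  rw [map_mul, map_mulTensor, map_mulTensor] at this
  exact this

theorem eps_one : eps K H 1 = 1 := by
  simp [eps, Algebra.TensorProduct.one_def, bracket_one]


theorem eps_of_isGroupLikeElem {γ : H} (hγ : IsGroupLikeElem K γ) :
    eps K H γ = bracket K H γ * bracket K H (HopfAlgebra.antipode K γ) := by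
  simp [eps, hγ.comul_eq_tmul_self]

theorem bracket_mul_eps_of_isGroupLikeElem {γ : H} (hγ : IsGroupLikeElem K γ) (k : H) :
    bracket K H γ * eps K H k = eps K H (γ * k) * bracket K H γ := by
  rw [bracket_mul_eps, eps_mul_bracket, Bialgebra.comul_mul, hγ.comul_eq_tmul_self]
  induction Coalgebra.comul (R := K) k with
  | zero => simp
  | tmul a b =>
    simp [HopfAlgebra.antipode_mul_antidistrib, mul_assoc, hγ.antipode_mul_cancel]
  | add s t hs ht => simp only [map_add, mul_add, hs, ht]

theorem eps_mul_bracket_antipode_of_isGroupLikeElem {γ : H} (hγ : IsGroupLikeElem K γ) (k : H) :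
    eps K H k * bracket K H (HopfAlgebra.antipode K γ) =
      bracket K H (HopfAlgebra.antipode K γ) * eps K H (γ * k) := by
  rw [bracket_mul_eps, eps_mul_bracket, Bialgebra.comul_mul, hγ.comul_eq_tmul_self]
  induction Coalgebra.comul (R := K) k with
  | zero => simp
  | tmul a b =>
    simp [HopfAlgebra.antipode_mul_antidistrib, ← mul_assoc, hγ.antipode_mul_cancel]
  | add s t hs ht => simp only [map_add, mul_add, hs, ht]

theorem commute_eps_eps_mul {γ : H} (hγ : IsGroupLikeElem K γ) (k : H) :
    eps K H γ * eps K H (γ * k) = eps K H (γ * k) * eps K H γ := by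
  rw [eps_of_isGroupLikeElem hγ, mul_assoc, ← eps_mul_bracket_antipode_of_isGroupLikeElem hγ,
    ← mul_assoc, bracket_mul_eps_of_isGroupLikeElem hγ, mul_assoc]

/-! ### The relations at a skew primitive element -/

section SkewPrimitive

variable {γ γ' ξ : H}

theorem counit_of_skewPrimitive (hγ : IsGroupLikeElem K γ) (hγ' : IsGroupLikeElem K γ')
    (hξ : Coalgebra.comul (R := K) ξ = ξ ⊗ₜ γ' + γ ⊗ₜ ξ) : Coalgebra.counit (R := K) ξ = 0 := by
  have h := congrArg (Coalgebra.counit (R := K) ∘ₗ (TensorProduct.lid K H).toLinearMap)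
    (Coalgebra.rTensor_counit_comul (R := K) ξ)
  simpa [hξ, hγ.counit_eq_one, hγ'.counit_eq_one] using h

theorem antipode_mul_of_skewPrimitive (hγ : IsGroupLikeElem K γ) (hγ' : IsGroupLikeElem K γ')
    (hξ : Coalgebra.comul (R := K) ξ = ξ ⊗ₜ γ' + γ ⊗ₜ ξ) :
    HopfAlgebra.antipode K γ * ξ = -(HopfAlgebra.antipode K ξ * γ') := by
  have h := HopfAlgebra.mul_antipode_rTensor_comul_apply (R := K) ξ
  simp only [hξ, counit_of_skewPrimitive hγ hγ' hξ, map_add, LinearMap.rTensor_tmul,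
    LinearMap.mul'_apply, map_zero] at h
  exact eq_neg_of_add_eq_zero_right h

theorem eps_of_skewPrimitive (hξ : Coalgebra.comul (R := K) ξ = ξ ⊗ₜ γ' + γ ⊗ₜ ξ) :
    eps K H ξ = bracket K H ξ * bracket K H (HopfAlgebra.antipode K γ') +
      bracket K H γ * bracket K H (HopfAlgebra.antipode K ξ) := by
  simp [eps, hξ]

theorem bracket_mul_eps_of_skewPrimitive (hγ : IsGroupLikeElem K γ) (hγ' : IsGroupLikeElem K γ')
    (hξ : Coalgebra.comul (R := K) ξ = ξ ⊗ₜ γ' + γ ⊗ₜ ξ) (k : H) :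
    bracket K H ξ * eps K H k =
      eps K H (ξ * k) * bracket K H γ' + eps K H (γ * k) * bracket K H ξ := by
  rw [bracket_mul_eps, eps_mul_bracket, eps_mul_bracket, Bialgebra.comul_mul, Bialgebra.comul_mul,
    hγ.comul_eq_tmul_self, hξ]
  induction Coalgebra.comul (R := K) k with
  | zero => simp
  | tmul a b =>
    simp [add_mul, HopfAlgebra.antipode_mul_antidistrib, mul_assoc, hγ'.antipode_mul_cancel,
      antipode_mul_of_skewPrimitive hγ hγ' hξ]
  | add s t hs ht => simp only [map_add, mul_add, hs, ht]; abel

theorem eps_mul_bracket_antipode_of_skewPrimitive (hγ : IsGroupLikeElem K γ)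
    (hγ' : IsGroupLikeElem K γ')
    (hξ : Coalgebra.comul (R := K) ξ = ξ ⊗ₜ γ' + γ ⊗ₜ ξ) (k : H) :
    eps K H k * bracket K H (HopfAlgebra.antipode K ξ) =
      bracket K H (HopfAlgebra.antipode K ξ) * eps K H (γ' * k) +
        bracket K H (HopfAlgebra.antipode K γ) * eps K H (ξ * k) := by
  rw [bracket_mul_eps, bracket_mul_eps, eps_mul_bracket, Bialgebra.comul_mul, Bialgebra.comul_mul,
    hγ'.comul_eq_tmul_self, hξ]
  induction Coalgebra.comul (R := K) k with
  | zero => simp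
  | tmul a b =>
    simp [add_mul, HopfAlgebra.antipode_mul_antidistrib, ← mul_assoc, hγ.antipode_mul_cancel,
      antipode_mul_of_skewPrimitive hγ hγ' hξ]
  | add s t hs ht => simp only [map_add, mul_add, hs, ht]; abel

/-- The element `∑ ε_{h₁} ε_{h₂ k}` for `h` skew primitive, in the form `∑ [h₁] ε_k [S(h₂)]`. -/
theorem eps_mul_eps_mul_of_skewPrimitive (hγ : IsGroupLikeElem K γ) (hγ' : IsGroupLikeElem K γ')
    (hξ : Coalgebra.comul (R := K) ξ = ξ ⊗ₜ γ' + γ ⊗ₜ ξ) (k : H) :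
    eps K H ξ * eps K H (γ' * k) + eps K H γ * eps K H (ξ * k) =
      bracket K H ξ * eps K H k * bracket K H (HopfAlgebra.antipode K γ') +
        bracket K H γ * eps K H k * bracket K H (HopfAlgebra.antipode K ξ) := by
  rw [eps_of_skewPrimitive hξ, eps_of_isGroupLikeElem hγ, mul_assoc (bracket K H ξ) (eps K H k),
    mul_assoc (bracket K H γ) (eps K H k),
    eps_mul_bracket_antipode_of_isGroupLikeElem hγ',
    eps_mul_bracket_antipode_of_skewPrimitive hγ hγ' hξ]
  noncomm_ring

/-- The relation `∑ ε_{h₁} ε_{h₂ k} = ∑ ε_{h₁ k} ε_{h₂}` at a skew primitive element `h = ξ`. -/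
theorem eps_skewPrimitive_comm (hγ : IsGroupLikeElem K γ) (hγ' : IsGroupLikeElem K γ')
    (hξ : Coalgebra.comul (R := K) ξ = ξ ⊗ₜ γ' + γ ⊗ₜ ξ) (k : H) :
    eps K H ξ * eps K H (γ' * k) + eps K H γ * eps K H (ξ * k) =
      eps K H (ξ * k) * eps K H γ' + eps K H (γ * k) * eps K H ξ := by
  rw [eps_mul_eps_mul_of_skewPrimitive hγ hγ' hξ, bracket_mul_eps_of_skewPrimitive hγ hγ' hξ,
    bracket_mul_eps_of_isGroupLikeElem hγ, eps_of_skewPrimitive hξ, eps_of_isGroupLikeElem hγ']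
  noncomm_ring

/-- The relation `ε_h = ∑ ε_{h₁} ε_{h₂}` at a skew primitive element `h = ξ`. -/
theorem eps_skewPrimitive_idem (hγ : IsGroupLikeElem K γ) (hγ' : IsGroupLikeElem K γ')
    (hξ : Coalgebra.comul (R := K) ξ = ξ ⊗ₜ γ' + γ ⊗ₜ ξ) :
    eps K H ξ * eps K H γ' + eps K H γ * eps K H ξ = eps K H ξ := by
  have h := eps_mul_eps_mul_of_skewPrimitive hγ hγ' hξ 1
  rwa [mul_one, mul_one, eps_one, mul_one, mul_one, ← eps_of_skewPrimitive hξ] at h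

end SkewPrimitive

theorem eps_mul_self_of_isGroupLikeElem {γ : H} (hγ : IsGroupLikeElem K γ) :
    eps K H γ * eps K H γ = eps K H γ := by
  have h := eps_mul_bracket_antipode_of_isGroupLikeElem hγ 1
  rw [eps_one, one_mul, mul_one] at h
  conv_lhs => rw [eps_of_isGroupLikeElem hγ, mul_assoc, ← eps_of_isGroupLikeElem hγ, ← h]
  exact (eps_of_isGroupLikeElem hγ).symm

end Hpar
end PartialHopfRelations

/-! ### The base algebra -/

namespace Apar

variable {K : Type*} [Field K] {H : Type*} [Ring H] [HopfAlgebra K H]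

theorem eps_add (h k : H) : eps K H (h + k) = eps K H h + eps K H k :=
  Subtype.ext (map_add (Hpar.eps K H) h k)

theorem eps_smul (c : K) (h : H) : eps K H (c • h) = c • eps K H h :=
  Subtype.ext (map_smul (Hpar.eps K H) c h)

theorem induction {p : Apar K H → Prop} (hc : ∀ c : K, p (algebraMap K (Apar K H) c))
    (heps : ∀ h, p (eps K H h)) (hmul : ∀ a b, p a → p b → p (a * b))
    (hadd : ∀ a b, p a → p b → p (a + b)) (a : Apar K H) : p a := by
  obtain ⟨a, ha⟩ := a
  induction ha using Algebra.adjoin_induction with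
  | mem a h => obtain ⟨h, rfl⟩ := h; exact heps h
  | algebraMap c => exact hc c
  | add a b ha hb iha ihb => exact hadd _ _ iha ihb
  | mul a b ha hb iha ihb => exact hmul _ _ iha ihb

theorem eps_mem_center {γ : H} (hγ : IsGroupLikeElem K γ) :
    eps K H γ ∈ Subalgebra.center K (Apar K H) := by
  rw [Subalgebra.mem_center_iff]
  intro a
  induction a using induction with
  | hc c => exact Algebra.commutes c _
  | heps h =>
    have h1 := Hpar.commute_eps_eps_mul hγ (HopfAlgebra.antipode K γ * h)
    rw [← mul_assoc, hγ.mul_antipode_cancel, one_mul] at h1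
    exact Subtype.ext h1.symm
  | hmul a b ha hb => rw [mul_assoc, hb, ← mul_assoc, ha, mul_assoc]
  | hadd a b ha hb => rw [add_mul, mul_add, ha, hb]

end Apar

namespace RankOne

variable {K : Type*} [Field K] {κ : K}

/-! ### Computations in the Hopf algebra of rank one -/

theorem isGroupLikeElem_g_pow (κ : K) (n : ℕ) : IsGroupLikeElem K (g κ ^ n) :=
  IsGroupLikeElem.pow ⟨counit_g κ, comul_g κ⟩

theorem x_mul_g_pow (κ : K) (n : ℕ) : x κ * g κ ^ n = (-1 : K) ^ n • (g κ ^ n * x κ) := by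
  induction n with
  | zero => simp
  | succ n ih =>
    rw [pow_succ, ← mul_assoc, ih, smul_mul_assoc, mul_assoc, x_mul_g, mul_neg, ← mul_assoc,
      pow_succ, mul_neg_one, neg_smul, smul_neg]

theorem comul_g_pow_mul_x (κ : K) (n : ℕ) : Coalgebra.comul (R := K) (g κ ^ n * x κ) =
    (g κ ^ n * x κ) ⊗ₜ (g κ ^ (n + 1)) + (g κ ^ n) ⊗ₜ (g κ ^ n * x κ) := by
  rw [Bialgebra.comul_mul, (isGroupLikeElem_g_pow κ n).comul_eq_tmul_self, comul_x, mul_add,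
    Algebra.TensorProduct.tmul_mul_tmul, Algebra.TensorProduct.tmul_mul_tmul, mul_one, pow_succ]

theorem g_pow_mod (κ : K) (n : ℕ) : g κ ^ (n % 4) = g κ ^ n :=
  (pow_eq_pow_mod n (g_pow_four κ)).symm

theorem g_pow_val_add (κ : K) (l m : Fin 4) :
    g κ ^ ((l + m : Fin 4) : ℕ) = g κ ^ (l : ℕ) * g κ ^ (m : ℕ) := by
  rw [Fin.val_add, g_pow_mod, pow_add]

theorem neg_one_pow_val_add {R : Type*} [Ring R] (l m : Fin 4) :
    (-1 : R) ^ ((l + m : Fin 4) : ℕ) = (-1) ^ (l : ℕ) * (-1) ^ (m : ℕ) := by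
  rw [Fin.val_add, ← pow_add]
  exact (pow_eq_pow_mod _ (by norm_num)).symm

/-- A property of elements of `H κ` that is stable under linear combinations holds everywhere if it
holds at the elements `gˡ` and `gˡ x`. -/
theorem induction_basis (κ : K) {p : H κ → Prop} (hg : ∀ l : Fin 4, p (g κ ^ (l : ℕ)))
    (hx : ∀ l : Fin 4, p (g κ ^ (l : ℕ) * x κ)) (hadd : ∀ a b, p a → p b → p (a + b))
    (hsmul : ∀ (c : K) a, p a → p (c • a)) (a : H κ) : p a := by
  have hg' : ∀ n : ℕ, p (g κ ^ n) := fun n => by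
    rw [← g_pow_mod]; exact hg ⟨n % 4, Nat.mod_lt _ (by norm_num)⟩
  have hx' : ∀ n : ℕ, p (g κ ^ n * x κ) := fun n => by
    rw [← g_pow_mod]; exact hx ⟨n % 4, Nat.mod_lt _ (by norm_num)⟩
  -- the span of the `gⁿ` and `gⁿ x` is stable under left multiplication by `H κ`
  let s : Set (H κ) := Set.range (fun n : ℕ => g κ ^ n) ∪ Set.range (fun n : ℕ => g κ ^ n * x κ)
  have hs : ∀ b ∈ Submodule.span K s, p b := by
    intro b hb
    induction hb using Submodule.span_induction with
    | mem b hb => rcases hb with ⟨n, rfl⟩ | ⟨n, rfl⟩ <;> simp only [hg', hx']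
    | zero => simpa using hsmul 0 _ (hg' 0)
    | add b c _ _ ihb ihc => exact hadd _ _ ihb ihc
    | smul c b _ ih => exact hsmul _ _ ih
  have mg : ∀ n : ℕ, g κ ^ n ∈ Submodule.span K s := fun n =>
    Submodule.subset_span (Or.inl ⟨n, rfl⟩)
  have mx : ∀ n : ℕ, g κ ^ n * x κ ∈ Submodule.span K s := fun n =>
    Submodule.subset_span (Or.inr ⟨n, rfl⟩)
  have key : ∀ u : H κ, (∀ n : ℕ, u * g κ ^ n ∈ Submodule.span K s) →
      (∀ n : ℕ, u * (g κ ^ n * x κ) ∈ Submodule.span K s) →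
      ∀ b ∈ Submodule.span K s, u * b ∈ Submodule.span K s := by
    intro u h1 h2 b hb
    induction hb using Submodule.span_induction with
    | mem b hb => rcases hb with ⟨n, rfl⟩ | ⟨n, rfl⟩ <;> simp only [h1, h2]
    | zero => simp
    | add b c _ _ ihb ihc => rw [mul_add]; exact add_mem ihb ihc
    | smul c b _ ih => rw [mul_smul_comm]; exact Submodule.smul_mem _ _ ih
  have h : ∀ b ∈ Submodule.span K s, a * b ∈ Submodule.span K s := by
    induction a using induction with
    | hc c =>
      intro b hb
      rw [← Algebra.smul_def]
      exact Submodule.smul_mem _ _ hb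
    | hg =>
      refine key _ (fun n => ?_) fun n => ?_
      · rw [← pow_succ']; exact mg _
      · rw [← mul_assoc, ← pow_succ']; exact mx _
    | hx =>
      refine key _ (fun n => ?_) fun n => ?_
      · rw [x_mul_g_pow]; exact Submodule.smul_mem _ _ (mx n)
      · rw [← mul_assoc, x_mul_g_pow, smul_mul_assoc, mul_assoc, ← pow_two, x_sq, mul_smul_comm,
          mul_sub, mul_one, ← pow_add]
        exact Submodule.smul_mem _ _ (Submodule.smul_mem _ _ (sub_mem (mg _) (mg _)))
    | hmul a b ha hb => intro c hc; rw [mul_assoc]; exact ha _ (hb _ hc)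
    | hadd a b ha hb => intro c hc; rw [add_mul]; exact add_mem (ha _ hc) (hb _ hc)
  have h1 := h 1 (by simpa using mg 0)
  rw [mul_one] at h1
  exact hs _ h1

/-! ### The relations between the generators of `A` -/

theorem epsG_zero : epsG κ 0 = 1 :=
  Subtype.ext (by simpa [epsG, Apar.eps] using Hpar.eps_one (K := K) (H := H κ))

theorem epsG_mul_self (l : Fin 4) : epsG κ l * epsG κ l = epsG κ l :=
  Subtype.ext (Hpar.eps_mul_self_of_isGroupLikeElem (isGroupLikeElem_g_pow κ l))

theorem epsG_mem_center (l : Fin 4) : epsG κ l ∈ Subalgebra.center K (A κ) :=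
  Apar.eps_mem_center (isGroupLikeElem_g_pow κ l)

theorem epsG_comm (l : Fin 4) (a : A κ) : epsG κ l * a = a * epsG κ l :=
  (Subalgebra.mem_center_iff.mp (epsG_mem_center l) a).symm

theorem eps_g_pow_succ (l : Fin 4) : Apar.eps K (H κ) (g κ ^ ((l : ℕ) + 1)) = epsG κ (l + 1) := by
  rw [epsG, g_pow_val_add, pow_succ]; simp

/-- The relation `ε_h = ∑ ε_{h₁} ε_{h₂}` at `h = gˡ x`. -/
theorem epsX_idem (l : Fin 4) :
    epsX κ l * epsG κ (l + 1) + epsG κ l * epsX κ l = epsX κ l := by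
  rw [← eps_g_pow_succ]
  exact Subtype.ext (Hpar.eps_skewPrimitive_idem (isGroupLikeElem_g_pow κ l)
    (isGroupLikeElem_g_pow κ (l + 1)) (comul_g_pow_mul_x κ l))

/-- The relation `∑ ε_{h₁} ε_{h₂ k} = ∑ ε_{h₁ k} ε_{h₂}` at `h = gˡ x`. -/
theorem epsX_mul_eps_comm (l : Fin 4) (k : H κ) :
    epsX κ l * Apar.eps K (H κ) (g κ ^ ((l : ℕ) + 1) * k) +
        epsG κ l * Apar.eps K (H κ) (g κ ^ (l : ℕ) * x κ * k) =
      Apar.eps K (H κ) (g κ ^ (l : ℕ) * x κ * k) * epsG κ (l + 1) +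
        Apar.eps K (H κ) (g κ ^ (l : ℕ) * k) * epsX κ l := by
  rw [← eps_g_pow_succ]
  exact Subtype.ext (Hpar.eps_skewPrimitive_comm (isGroupLikeElem_g_pow κ l)
    (isGroupLikeElem_g_pow κ (l + 1)) (comul_g_pow_mul_x κ l) k)

theorem g_pow_mul_x_mul_g_pow (l m : Fin 4) : g κ ^ (l : ℕ) * x κ * g κ ^ (m : ℕ) =
    (-1 : K) ^ (m : ℕ) • (g κ ^ ((l + m : Fin 4) : ℕ) * x κ) := by
  rw [mul_assoc, x_mul_g_pow, mul_smul_comm, g_pow_val_add, mul_assoc]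

theorem g_pow_mul_x_mul_g_pow_mul_x (l m : Fin 4) :
    g κ ^ (l : ℕ) * x κ * (g κ ^ (m : ℕ) * x κ) =
      ((-1 : K) ^ (m : ℕ) * κ) •
        (g κ ^ ((l + m + 2 : Fin 4) : ℕ) + (-1 : K) • g κ ^ ((l + m : Fin 4) : ℕ)) := by
  rw [← mul_assoc, g_pow_mul_x_mul_g_pow, smul_mul_assoc, mul_assoc, ← pow_two, x_sq,
    mul_smul_comm, mul_sub, mul_one, g_pow_val_add κ (l + m) 2, smul_smul, neg_one_smul,
    ← sub_eq_add_neg]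
  rfl

theorem epsX_epsG_comm (l m : Fin 4) :
    epsX κ l * epsG κ (l + 1 + m) + (-1 : K) ^ (m : ℕ) • (epsG κ l * epsX κ (l + m)) =
      (-1 : K) ^ (m : ℕ) • (epsX κ (l + m) * epsG κ (l + 1)) + epsG κ (l + m) * epsX κ l := by
  have h := epsX_mul_eps_comm (κ := κ) l (g κ ^ (m : ℕ))
  have e : g κ ^ ((l : ℕ) + 1) = g κ ^ ((l + 1 : Fin 4) : ℕ) := by
    rw [g_pow_val_add, pow_succ]; simp
  rw [e, g_pow_mul_x_mul_g_pow, Apar.eps_smul, ← g_pow_val_add, ← g_pow_val_add, mul_smul_comm,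
    smul_mul_assoc] at h
  exact h

theorem epsX_epsX_comm (l m : Fin 4) :
    epsX κ l * epsX κ (l + 1 + m) +
        ((-1 : K) ^ (m : ℕ) * κ) • (epsG κ l * (epsG κ (l + m + 2) - epsG κ (l + m))) =
      ((-1 : K) ^ (m : ℕ) * κ) • ((epsG κ (l + m + 2) - epsG κ (l + m)) * epsG κ (l + 1)) +
        epsX κ (l + m) * epsX κ l := by
  have h := epsX_mul_eps_comm (κ := κ) l (g κ ^ (m : ℕ) * x κ)
  have e : g κ ^ ((l : ℕ) + 1) = g κ ^ ((l + 1 : Fin 4) : ℕ) := by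
    rw [g_pow_val_add, pow_succ]; simp
  rw [e, g_pow_mul_x_mul_g_pow_mul_x, Apar.eps_smul, Apar.eps_add, Apar.eps_smul, neg_one_smul,
    ← sub_eq_add_neg, ← mul_assoc, ← mul_assoc, ← g_pow_val_add, ← g_pow_val_add, mul_smul_comm,
    smul_mul_assoc] at h
  exact h

end RankOne

/-! ### The idempotents -/

namespace RankOne

/-- The element `P_X` attached to a family `c` of elements of a ring: the product of the `c l` with
`l ∈ X` and the `1 - c l` with `l ∉ X`. As the ring need not be commutative, the factors are taken
in the same order as in `RankOne.P`. -/
def splitProd {R : Type*} [Ring R] (c : Fin 4 → R) (X : Finset (Fin 4)) : R :=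
  (((List.finRange 4).filter (fun l => l ∈ X)).map c).prod *
    (((List.finRange 4).filter (fun l => l ∉ X)).map (fun l => 1 - c l)).prod

section Center

variable {R : Type*} [CommRing R]

theorem prod_map_mul_self {ι : Type*} (c : ι → R) (L : List ι) {l : ι} (hl : l ∈ L)
    (hc : c l * c l = c l) : (L.map c).prod * c l = (L.map c).prod := by
  obtain ⟨L₁, L₂, rfl⟩ := List.append_of_mem hl
  simp only [List.map_append, List.map_cons, List.prod_append, List.prod_cons]
  linear_combination (L₁.map c).prod * (L₂.map c).prod * hc

theorem splitProd_mul_of_mem (c : Fin 4 → R) (hc : ∀ l, c l * c l = c l) {X : Finset (Fin 4)}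
    {l : Fin 4} (hl : l ∈ X) : splitProd c X * c l = splitProd c X := by
  rw [splitProd, mul_right_comm, prod_map_mul_self c _ (by simpa using hl) (hc l)]

theorem splitProd_mul_of_notMem (c : Fin 4 → R) (hc : ∀ l, c l * c l = c l) {X : Finset (Fin 4)}
    {l : Fin 4} (hl : l ∉ X) : splitProd c X * c l = 0 := by
  have h : splitProd c X * (1 - c l) = splitProd c X := by
    rw [splitProd, mul_assoc, prod_map_mul_self (fun l => 1 - c l) _ (by simpa using hl)]
    linear_combination hc l
  linear_combination -h

theorem splitProd_mul_self (c : Fin 4 → R) (hc : ∀ l, c l * c l = c l) (X : Finset (Fin 4)) :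
    splitProd c X * splitProd c X = splitProd c X := by
  have h : ∀ L : List (Fin 4), (∀ l ∈ L, l ∈ X) →
      splitProd c X * (L.map c).prod = splitProd c X := by
    intro L hL
    induction L with
    | nil => simp
    | cons l L ih =>
      rw [List.map_cons, List.prod_cons, ← mul_assoc, splitProd_mul_of_mem c hc (hL l (by simp)),
        ih fun m hm => hL m (by simp [hm])]
  have h' : ∀ L : List (Fin 4), (∀ l ∈ L, l ∉ X) →
      splitProd c X * (L.map fun l => 1 - c l).prod = splitProd c X := by
    intro L hL
    induction L with
    | nil => simp
    | cons l L ih =>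
      rw [List.map_cons, List.prod_cons, ← mul_assoc, mul_sub, mul_one,
        splitProd_mul_of_notMem c hc (hL l (by simp)), sub_zero,
        ih fun m hm => hL m (by simp [hm])]
  conv_lhs => rhs; rw [splitProd]
  rw [← mul_assoc, h _ (by simp), h' _ (by simp)]

theorem sum_splitProd (c : Fin 4 → R) : ∑ X, splitProd c X = 1 := by
  have h := Finset.prod_add c (fun l => 1 - c l) Finset.univ
  rw [Finset.powerset_univ] at h
  rw [Finset.prod_eq_one fun l _ => add_sub_cancel (c l) 1] at h
  rw [h]
  refine Finset.sum_congr rfl fun X _ => ?_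
  have e : X = Finset.univ.filter (· ∈ X) := by ext; simp
  have e' : Finset.univ \ X = Finset.univ.filter (· ∉ X) := by ext; simp
  rw [e']
  conv_rhs => lhs; rw [e]
  rfl

end Center

section Central

variable {R : Type*} [Ring R]

theorem coe_splitProd (c : Fin 4 → Subring.center R) (X : Finset (Fin 4)) :
    (splitProd c X).1 = splitProd (fun l => (c l : R)) X := by
  change (Subring.center R).subtype (splitProd c X) = _
  rw [splitProd, splitProd, map_mul, map_list_prod, map_list_prod, List.map_map, List.map_map]
  rfl

/-- The properties of the elements `P_X` of a commutative ring hold more generally for a family of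
central idempotents of a ring. -/
theorem splitProd_spec {c : Fin 4 → R} (hc : ∀ l, c l ∈ Subring.center R)
    (hc' : ∀ l, c l * c l = c l) :
    (∀ X, splitProd c X ∈ Subring.center R) ∧
    (∀ X, splitProd c X * splitProd c X = splitProd c X) ∧
    (∀ X, ∀ l ∈ X, splitProd c X * c l = splitProd c X) ∧
    (∀ X, ∀ l ∉ X, splitProd c X * c l = 0) ∧
    ∑ X, splitProd c X = 1 := by
  obtain ⟨c, rfl⟩ : ∃ d : Fin 4 → Subring.center R, (fun l => (d l : R)) = c :=
    ⟨fun l => ⟨c l, hc l⟩, rfl⟩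
  have hd : ∀ l, c l * c l = c l := fun l => Subtype.ext (hc' l)
  simp only [← coe_splitProd]
  refine ⟨fun X => (splitProd c X).2, fun X => ?_, fun X l hl => ?_, fun X l hl => ?_, ?_⟩
  · rw [← Subring.coe_mul, splitProd_mul_self c hd]
  · rw [← Subring.coe_mul, splitProd_mul_of_mem c hd hl]
  · rw [← Subring.coe_mul, splitProd_mul_of_notMem c hd hl, Subring.coe_zero]
  · have h := congrArg (Subring.center R).subtype (sum_splitProd c)
    rw [map_sum, map_one] at h
    exact h

end Central

variable {K : Type*} [Field K] {κ : K}

theorem splitProd_epsG_spec (κ : K) :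
    (∀ X, P κ X ∈ Subring.center (A κ)) ∧
    (∀ X, P κ X * P κ X = P κ X) ∧
    (∀ X, ∀ l ∈ X, P κ X * epsG κ l = P κ X) ∧
    (∀ X, ∀ l ∉ X, P κ X * epsG κ l = 0) ∧
    ∑ X, P κ X = 1 :=
  splitProd_spec (c := epsG κ)
    (fun l => Subring.mem_center_iff.mpr fun a => (epsG_comm l a).symm) epsG_mul_self

theorem P_comm (X : Finset (Fin 4)) (a : A κ) : P κ X * a = a * P κ X :=
  (Subring.mem_center_iff.mp ((splitProd_epsG_spec κ).1 X) a).symm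

theorem P_mem_center (X : Finset (Fin 4)) : P κ X ∈ Subalgebra.center K (A κ) :=
  Subalgebra.mem_center_iff.mpr fun a => (P_comm X a).symm

theorem P_mul_self (X : Finset (Fin 4)) : P κ X * P κ X = P κ X :=
  (splitProd_epsG_spec κ).2.1 X

/-- The indicator function of a set of exponents, with values in `K`. -/
def ind (K : Type*) [Field K] (X : Finset (Fin 4)) (l : Fin 4) : K := if l ∈ X then 1 else 0

theorem P_mul_epsG (X : Finset (Fin 4)) (l : Fin 4) :
    P κ X * epsG κ l = ind K X l • P κ X := by
  rw [ind]
  split_ifs with hl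
  · rw [(splitProd_epsG_spec κ).2.2.1 X l hl, one_smul]
  · rw [(splitProd_epsG_spec κ).2.2.2.1 X l hl, zero_smul]

theorem completeOrthogonalIdempotents_P :
    CompleteOrthogonalIdempotents (fun Y : P₁ => P κ Y.1) where
  idem Y := P_mul_self Y.1
  ortho := by
    have key : ∀ X Y : Finset (Fin 4), ∀ l, l ∈ X → l ∉ Y → P κ X * P κ Y = 0 := by
      intro X Y l hX hY
      have h : P κ X * epsG κ l * P κ Y = P κ X * (P κ Y * epsG κ l) := by
        rw [mul_assoc, epsG_comm]
      rw [P_mul_epsG, P_mul_epsG, ind, ind, if_pos hX, if_neg hY] at h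
      simpa using h
    intro X Y hXY
    have hne : X.1 ≠ Y.1 := fun h => hXY (Subtype.ext h)
    by_cases hsub : X.1 ⊆ Y.1
    · obtain ⟨l, hl, hl'⟩ := Finset.not_subset.mp fun h => hne (hsub.antisymm h)
      change P κ X.1 * P κ Y.1 = 0
      rw [P_comm]
      exact key _ _ l hl hl'
    · obtain ⟨l, hl, hl'⟩ := Finset.not_subset.mp hsub
      exact key _ _ l hl hl'
  complete := by
    have hz : ∀ X : Finset (Fin 4), 0 ∉ X → P κ X = 0 := by
      intro X hX
      have h := P_mul_epsG (κ := κ) X 0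
      rwa [epsG_zero, mul_one, ind, if_neg hX, zero_smul] at h
    rw [← (splitProd_epsG_spec κ).2.2.2.2, ← Finset.sum_filter_of_ne (p := fun X => 0 ∈ X)
      (fun X _ h => not_not.mp fun hX => h (hz X hX))]
    exact (Finset.sum_subtype _ (by simp) _).symm

/-! ### The relations in the summands -/

/-- The difference `χ(l + 1) - χ(l)` for the indicator function `χ` of `X`. -/
def jump (K : Type*) [Field K] (X : Finset (Fin 4)) (l : Fin 4) : K := ind K X (l + 1) - ind K X l

theorem P_mul_mul (X : Finset (Fin 4)) (a b : A κ) :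
    P κ X * (a * b) = (P κ X * a) * (P κ X * b) := by
  rw [mul_assoc, ← mul_assoc a, ← P_comm X a, mul_assoc, ← mul_assoc (P κ X) (P κ X), P_mul_self]

theorem jump_smul_P_mul_epsX (X : Finset (Fin 4)) (l m : Fin 4) :
    jump K X (l + m) • (P κ X * epsX κ l) =
      ((-1) ^ (m : ℕ) * jump K X l) • (P κ X * epsX κ (l + m)) := by
  have h := congrArg (P κ X * ·) (epsX_epsG_comm (κ := κ) l m)
  simp only [mul_add, mul_smul_comm, ← epsG_comm _ (epsX κ _), ← mul_assoc, P_mul_epsG,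
    smul_mul_assoc] at h
  rw [jump, jump, add_right_comm l m 1]
  rw [← sub_eq_zero] at h ⊢
  rw [← h]
  module

/-- From `epsX_idem`: if both `gˡ` and `gˡ⁺¹` belong to `X`, then `P_X ε_{gˡ x}` is equal to twice
itself. -/
theorem P_mul_epsX_eq_zero (X : Finset (Fin 4)) (l : Fin 4) (hl : l ∈ X) (hl' : l + 1 ∈ X) :
    P κ X * epsX κ l = 0 := by
  have h := congrArg (P κ X * ·) (epsX_idem (κ := κ) l)
  simp only [mul_add, ← epsG_comm _ (epsX κ _), ← mul_assoc, P_mul_epsG, ind, if_pos hl,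
    if_pos hl', one_smul] at h
  simpa using h

theorem jump_mul_self (X : Finset (Fin 4)) (l : Fin 4) (hl : jump K X l ≠ 0) :
    jump K X l * jump K X l = 1 := by
  simp only [jump, ind] at hl ⊢
  split_ifs at hl ⊢ <;> simp_all

/-- All the `P_X ε_{gᵐ x}` are multiples of a single one: since `d_l² = 1` as soon as
`d_l = χ(l + 1) - χ(l)` is not zero, the relation `jump_smul_P_mul_epsX` can be solved for
`P_X ε_{gˡ⁺ᵐ x}`. -/
theorem P_mul_epsX (X : Finset (Fin 4)) (l m : Fin 4) (hl : jump K X l ≠ 0) :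
    P κ X * epsX κ (l + m) =
      ((-1) ^ (m : ℕ) * jump K X l * jump K X (l + m)) • (P κ X * epsX κ l) := by
  rw [mul_smul, jump_smul_P_mul_epsX, smul_smul]
  have h : (-1 : K) ^ (m : ℕ) * (-1) ^ (m : ℕ) = 1 := by rw [← mul_pow]; simp
  rw [show (-1) ^ (m : ℕ) * jump K X l * ((-1) ^ (m : ℕ) * jump K X l) = (1 : K) by
    linear_combination jump K X l * jump K X l * h + jump_mul_self X l hl, one_smul]

/-- Multiply the relation `epsX_epsX_comm` by `P_X` and express everything in `P_X ε_{gˡ x}`: the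
result is `P_X ε_{gˡ x}² + κ P_X = 0`, up to a factor that the hypotheses make invertible. -/
theorem P_mul_epsX_sq (X : Finset (Fin 4)) (l m : Fin 4) (hl : jump K X l ≠ 0)
    (hm : ind K X (l + m + 2) - ind K X (l + m) ≠ 0) :
    P κ X * epsX κ l ^ 2 = -(κ • P κ X) := by
  have h := congrArg (P κ X * ·) (epsX_epsX_comm (κ := κ) l m)
  simp only [mul_add] at h
  rw [mul_smul_comm, mul_smul_comm, P_mul_mul X (epsX κ l), P_mul_mul X (epsX κ (l + m)),
    P_mul_mul X (epsG κ l), P_mul_mul X (_ - _), add_assoc l 1 m, P_mul_epsX X l (1 + m) hl,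
    P_mul_epsX X l m hl, mul_sub, P_mul_epsG, P_mul_epsG, P_mul_epsG, P_mul_epsG] at h
  rw [pow_two, P_mul_mul, ← sub_eq_zero]
  rw [← sub_eq_zero] at h
  simp only [mul_smul_comm, smul_mul_assoc, ← sub_smul, P_mul_self] at h
  have e₁ : (-1 : K) ^ ((1 + m : Fin 4) : ℕ) = -(-1) ^ (m : ℕ) := by
    rw [neg_one_pow_val_add]; simp
  have e₂ : jump K X (l + (1 + m)) = ind K X (l + m + 2) - ind K X (l + m + 1) := by
    rw [jump, show l + (1 + m) = l + m + 1 by abel, show l + m + 1 + 1 = l + m + 2 by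
      rw [add_assoc]; rfl]
  have e₃ : jump K X (l + m) = ind K X (l + m + 1) - ind K X (l + m) := rfl
  have e₄ : ind K X (l + 1) = jump K X l + ind K X l := (sub_add_cancel _ _).symm
  rw [e₁, e₂, e₃, e₄] at h
  have hs : (-1 : K) ^ (m : ℕ) ≠ 0 := pow_ne_zero _ (by simp)
  refine (smul_eq_zero_iff_right (mul_ne_zero (mul_ne_zero hs hl) hm)).mp ?_
  rw [← neg_eq_zero, ← h]
  module

end RankOne

/-! ### Compressions of representations -/

section Compression

variable {K : Type*} [Field K] {H : Type*} [Ring H] [HopfAlgebra K H] {E : Type*} [Ring E]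
  [Algebra K E]

/-- The inclusion of the corner of an idempotent, as a linear map. -/
def cornerVal {T : E} (hT : IsIdempotentElem T) : hT.Corner →ₗ[K] E where
  toFun a := a.1
  map_add' _ _ := rfl
  map_smul' _ _ := rfl

theorem cornerVal_injective {T : E} (hT : IsIdempotentElem T) :
    Function.Injective (cornerVal (K := K) hT) := Subtype.val_injective

theorem cornerVal_mul {T : E} (hT : IsIdempotentElem T) (a b : hT.Corner) :
    cornerVal (K := K) hT (a * b) = cornerVal (K := K) hT a * cornerVal (K := K) hT b := rfl

theorem cornerVal_one {T : E} (hT : IsIdempotentElem T) : cornerVal (K := K) hT 1 = T := rfl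

theorem cornerVal_algebraMap {T : E} (hT : IsIdempotentElem T) (c : K) :
    cornerVal (K := K) hT (algebraMap K hT.Corner c) = c • T := rfl

/-- The linear map `h ↦ ρ(h₁) T ρ(S(h₂))`, for an algebra map `ρ : H → E` and `T ∈ E`. -/
def conjMap (ρ : H →ₐ[K] E) (T : E) : H →ₗ[K] E :=
  mulTensor (LinearMap.mulRight K T ∘ₗ ρ.toLinearMap)
    (ρ.toLinearMap ∘ₗ HopfAlgebra.antipode K) ∘ₗ Coalgebra.comul

/-- The compression `h ↦ T ρ(h) T` of an algebra map `ρ : H → E` to the corner of an idempotent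
`T`. -/
def compress (ρ : H →ₐ[K] E) {T : E} (hT : IsIdempotentElem T) : H →ₗ[K] hT.Corner where
  toFun h := ⟨T * ρ h * T, ρ h, rfl⟩
  map_add' a b := Subtype.ext (by
    change T * ρ (a + b) * T = T * ρ a * T + T * ρ b * T
    rw [map_add, mul_add, add_mul])
  map_smul' c a := Subtype.ext (by
    change T * ρ (c • a) * T = c • (T * ρ a * T)
    rw [map_smul, mul_smul_comm, smul_mul_assoc])

variable (ρ : H →ₐ[K] E) {T : E} (hT : IsIdempotentElem T)

theorem cornerVal_compress (h : H) : cornerVal (K := K) hT (compress ρ hT h) = T * ρ h * T := rfl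

theorem compress_one : compress ρ hT 1 = 1 := by
  apply cornerVal_injective (K := K) hT
  rw [cornerVal_compress, map_one, mul_one, hT.eq, cornerVal_one]

/-- For `t = Δ k` and suitable `u` and `v`, this computes all the sums in the defining relations of
`H_par` after compression. -/
theorem cornerVal_mulTensor_compress (u v : H) (t : H ⊗[K] H) :
    cornerVal (K := K) hT (mulTensor (compress ρ hT ∘ₗ LinearMap.mulLeft K u)
      (compress ρ hT ∘ₗ LinearMap.mulRight K v ∘ₗ HopfAlgebra.antipode K) t) =
    T * ρ u * mulTensor (LinearMap.mulRight K T ∘ₗ ρ.toLinearMap)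
      (ρ.toLinearMap ∘ₗ HopfAlgebra.antipode K) t * ρ v * T := by
  induction t with
  | zero => simp
  | tmul a b =>
    have h : ∀ a : E, T * (T * a) = T * a := fun a => by rw [← mul_assoc, hT.eq]
    simp only [mulTensor_tmul, cornerVal_mul, LinearMap.comp_apply, cornerVal_compress, h,
      LinearMap.mulLeft_apply, LinearMap.mulRight_apply, map_mul, AlgHom.toLinearMap_apply,
      mul_assoc]
  | add s t hs ht => simp only [map_add, mul_add, add_mul, hs, ht]

variable {ρ}

theorem compress_mul_left (hcomm : ∀ h, T * conjMap ρ T h = conjMap ρ T h * T)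
    (h k : H) :
    compress ρ hT h * mulTensor (compress ρ hT) (compress ρ hT ∘ₗ HopfAlgebra.antipode K)
        (Coalgebra.comul (R := K) k) =
      mulTensor (compress ρ hT ∘ₗ LinearMap.mulLeft K h)
        (compress ρ hT ∘ₗ HopfAlgebra.antipode K) (Coalgebra.comul (R := K) k) := by
  apply cornerVal_injective (K := K) hT
  have h1 := cornerVal_mulTensor_compress ρ hT 1 1 (Coalgebra.comul (R := K) k)
  have h2 := cornerVal_mulTensor_compress ρ hT h 1 (Coalgebra.comul (R := K) k)
  rw [LinearMap.mulRight_one, LinearMap.id_comp] at h1 h2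
  rw [LinearMap.mulLeft_one, LinearMap.comp_id] at h1
  rw [cornerVal_mul, h1, h2, cornerVal_compress]
  change T * ρ h * T * (T * ρ 1 * conjMap ρ T k * ρ 1 * T) =
    T * ρ h * conjMap ρ T k * ρ 1 * T
  rw [map_one, mul_one, mul_one, mul_one, hcomm, mul_assoc _ T T, hT.eq, ← hcomm,
    mul_assoc (T * ρ h) T, ← mul_assoc T T, hT.eq, hcomm, ← mul_assoc]

theorem compress_mul_right (hcomm : ∀ h, T * conjMap ρ T h = conjMap ρ T h * T)
    (h k : H) :
    mulTensor (compress ρ hT) (compress ρ hT ∘ₗ HopfAlgebra.antipode K)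
        (Coalgebra.comul (R := K) h) * compress ρ hT k =
      mulTensor (compress ρ hT)
        (compress ρ hT ∘ₗ LinearMap.mulRight K k ∘ₗ HopfAlgebra.antipode K)
        (Coalgebra.comul (R := K) h) := by
  apply cornerVal_injective (K := K) hT
  have h1 := cornerVal_mulTensor_compress ρ hT 1 1 (Coalgebra.comul (R := K) h)
  have h2 := cornerVal_mulTensor_compress ρ hT 1 k (Coalgebra.comul (R := K) h)
  rw [LinearMap.mulLeft_one, LinearMap.comp_id] at h1 h2
  rw [LinearMap.mulRight_one, LinearMap.id_comp] at h1
  rw [cornerVal_mul, h1, h2, cornerVal_compress]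
  change T * ρ 1 * conjMap ρ T h * ρ 1 * T * (T * ρ k * T) =
    T * ρ 1 * conjMap ρ T h * ρ k * T
  rw [map_one, mul_one, mul_one, hcomm, mul_assoc _ T T, hT.eq, mul_assoc T (ρ k) T,
    ← mul_assoc _ T, mul_assoc _ T T, hT.eq, ← mul_assoc]

/-- If `T` commutes with all the `ρ(h₁) T ρ(S(h₂))`, then `h ↦ T ρ(h) T` is a partial representation
of `H`, that is, it extends to an algebra map from `H_par` to the corner of `T`. -/
def partialRep (hcomm : ∀ h, T * conjMap ρ T h = conjMap ρ T h * T) :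
    Hpar K H →ₐ[K] hT.Corner :=
  RingQuot.liftAlgHom K ⟨TensorAlgebra.lift K (compress ρ hT), by
    have hι : (TensorAlgebra.lift K (compress ρ hT)).toLinearMap ∘ₗ TensorAlgebra.ι K =
      compress ρ hT := LinearMap.ext fun a => by simp
    intro u v huv
    cases huv with
    | one =>
      exact (TensorAlgebra.lift_ι_apply _ _).trans ((compress_one ρ hT).trans (map_one _).symm)
    | left h k =>
      rw [map_mul, map_mulTensor, map_mulTensor, TensorAlgebra.lift_ι_apply,
        ← LinearMap.comp_assoc, ← LinearMap.comp_assoc, hι]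
      exact compress_mul_left hT hcomm h k
    | right h k =>
      rw [map_mul, map_mulTensor, map_mulTensor, TensorAlgebra.lift_ι_apply,
        ← LinearMap.comp_assoc, ← LinearMap.comp_assoc, hι]
      exact compress_mul_right hT hcomm h k⟩

theorem partialRep_bracket (hcomm : ∀ h, T * conjMap ρ T h = conjMap ρ T h * T)
    (h : H) :
    partialRep hT hcomm (Hpar.bracket K H h) = compress ρ hT h := by
  refine (RingQuot.liftAlgHom_mkAlgHom_apply K _ _ _).trans ?_
  exact TensorAlgebra.lift_ι_apply _ _

theorem cornerVal_partialRep_eps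
    (hcomm : ∀ h, T * conjMap ρ T h = conjMap ρ T h * T) (h : H) :
    cornerVal (K := K) hT (partialRep hT hcomm (Hpar.eps K H h)) = T * conjMap ρ T h := by
  have hb : (partialRep hT hcomm).toLinearMap ∘ₗ Hpar.bracket K H = compress ρ hT :=
    LinearMap.ext (partialRep_bracket hT hcomm)
  have h1 := cornerVal_mulTensor_compress ρ hT 1 1 (Coalgebra.comul (R := K) h)
  rw [LinearMap.mulLeft_one, LinearMap.comp_id, LinearMap.mulRight_one, LinearMap.id_comp] at h1
  rw [Hpar.eps, LinearMap.comp_apply, map_mulTensor, ← LinearMap.comp_assoc, hb, h1]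
  change T * ρ 1 * conjMap ρ T h * ρ 1 * T = _
  rw [map_one, mul_one, mul_one, hcomm, mul_assoc, hT.eq]

end Compression

/-! ### Algebra maps from `A` to a commutative algebra -/

namespace RankOne

section Convolution

variable (K : Type*) [Field K] (κ : K) (B : Type*) [CommRing B] [Algebra K B]

/-- The space of linear maps `φ : H → B`, where `φ` is given by its values at the elements `gⁱ`
(first component) and at the elements `gⁱ x` (second component). -/
abbrev Conv : Type _ := (Fin 4 → B) × (Fin 4 → B)

/-- The convolution product of linear maps `H → B`, as the operator of multiplication from the
left. -/
def convMul : Conv B →ₗ[K] Module.End K (Conv B) :=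
  LinearMap.mk₂ K
    (fun φ m => (fun i => φ.1 i * m.1 i, fun i => φ.1 i * m.2 i + φ.2 i * m.1 (i + 1)))
    (fun φ ψ m => by ext i <;> simp <;> ring)
    (fun c φ m => by ext i <;> simp)
    (fun φ m n => by ext i <;> simp <;> ring)
    (fun c φ m => by ext i <;> simp)

/-- The action of `g` on linear maps `φ : H → B` by `(g · φ)(k) = φ(k g)`. -/
def convG : Module.End K (Conv B) where
  toFun m := (fun i => m.1 (i + 1), fun i => -m.2 (i + 1))
  map_add' m n := by ext i <;> simp [add_comm]
  map_smul' c m := by ext i <;> simp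

/-- The action of `x` on linear maps `φ : H → B` by `(x · φ)(k) = φ(k x)`. -/
def convX : Module.End K (Conv B) where
  toFun m := (fun i => m.2 i, fun i => κ • (m.1 (i + 2) - m.1 i))
  map_add' m n := by ext i <;> simp [smul_sub, smul_add]; ring
  map_smul' c m := by ext i <;> simp [smul_sub, smul_comm c κ]

variable {K B}

theorem convMul_apply (φ m : Conv B) : convMul K B φ m =
    (fun i => φ.1 i * m.1 i, fun i => φ.1 i * m.2 i + φ.2 i * m.1 (i + 1)) := rfl

theorem convG_apply (m : Conv B) :
    convG K B m = (fun i => m.1 (i + 1), fun i => -m.2 (i + 1)) := rfl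

theorem convX_apply (m : Conv B) :
    convX K κ B m = (fun i => m.2 i, fun i => κ • (m.1 (i + 2) - m.1 i)) := rfl

theorem convG_pow_apply (l : Fin 4) (m : Conv B) :
    (convG K B ^ (l : ℕ)) m =
      (fun i => m.1 (i + l), fun i => (-1) ^ (l : ℕ) * m.2 (i + l)) := by
  have h : ∀ i : Fin 4, i + 1 + 1 = i + 2 ∧ i + 1 + 2 = i + 3 := by decide
  fin_cases l <;> ext i <;> simp [pow_succ, convG_apply, h]

/-- `(g · φ ψ) = (g · φ) (g · ψ)` for the convolution product. -/
theorem convG_mul_convMul (φ : Conv B) :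
    convG K B * convMul K B φ = convMul K B (convG K B φ) * convG K B := by
  ext m i <;> simp [convG_apply, convMul_apply]

/-- `x · φ ψ = (x · φ) (g · ψ) + φ (x · ψ)` for the convolution product. -/
theorem convX_mul_convMul (φ : Conv B) : convX K κ B * convMul K B φ =
    convMul K B (convX K κ B φ) * convG K B + convMul K B φ * convX K κ B := by
  have h : ∀ i : Fin 4, i + 1 + 1 = i + 2 := by decide
  refine LinearMap.ext fun m => Prod.ext (funext fun i => ?_) (funext fun i => ?_)
  · simp [convG_apply, convX_apply, convMul_apply]; ring
  · simp [convG_apply, convX_apply, convMul_apply, Algebra.smul_def, h]; ring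

theorem convMul_commute {φ ψ : Conv B}
    (h : ∀ i, φ.1 i * ψ.2 i + φ.2 i * ψ.1 (i + 1) = ψ.1 i * φ.2 i + ψ.2 i * φ.1 (i + 1)) :
    convMul K B φ * convMul K B ψ = convMul K B ψ * convMul K B φ := by
  refine LinearMap.ext fun m => Prod.ext (funext fun i => ?_) (funext fun i => ?_)
  · simp [convMul_apply]; ring
  · simp only [Module.End.mul_apply, convMul_apply]
    linear_combination m.1 (i + 1) * h i

/-- The representation of `H κ` on linear maps `φ : H → B` by `(h · φ)(k) = φ(k h)`. -/
def convRep : H κ →ₐ[K] Module.End K (Conv B) :=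
  lift κ (convG K B) (convX K κ B)
    (by
      have h : ∀ i : Fin 4, i + 1 + 1 + 1 + 1 = i := by decide
      refine LinearMap.ext fun m => Prod.ext (funext fun i => ?_) (funext fun i => ?_) <;>
        simp [pow_succ, convG_apply, h])
    (by
      have h : ∀ i : Fin 4, i + 1 + 1 = i + 2 := by decide
      refine LinearMap.ext fun m => Prod.ext (funext fun i => ?_) (funext fun i => ?_) <;>
        simp [pow_succ, convG_apply, convX_apply, h])
    (by
      have h : ∀ i : Fin 4, i + 2 + 1 = i + 1 + 2 := by decide
      refine LinearMap.ext fun m => Prod.ext (funext fun i => ?_) (funext fun i => ?_) <;>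
        simp [convG_apply, convX_apply, h])

theorem convRep_g_pow (n : ℕ) : convRep κ (B := B) (g κ ^ n) = convG K B ^ n := by
  rw [map_pow, convRep, lift_g]

theorem convRep_g_pow_mul_x (n : ℕ) :
    convRep κ (B := B) (g κ ^ n * x κ) = convG K B ^ n * convX K κ B := by
  rw [map_mul, convRep_g_pow, convRep, lift_x]

theorem convG_pow_mul_convMul (n : ℕ) (φ : Conv B) : convG K B ^ n * convMul K B φ =
    convMul K B ((convG K B ^ n) φ) * convG K B ^ n := by
  induction n with
  | zero => simp
  | succ n ih =>
    rw [pow_succ', mul_assoc, ih, ← mul_assoc, convG_mul_convMul, mul_assoc, Module.End.mul_apply]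

/-- Conjugation of a multiplication operator: `h₁ φ S(h₂) = h · φ`. -/
theorem conjMap_convMul (φ : Conv B) (h : H κ) :
    conjMap (convRep κ) (convMul K B φ) h = convMul K B (convRep κ h φ) := by
  induction h using induction_basis with
  | hg l =>
    have hl := isGroupLikeElem_g_pow κ l
    have e := congrArg (convRep κ (B := B)) hl.mul_antipode_cancel
    rw [map_mul, map_one] at e
    rw [conjMap, LinearMap.comp_apply, hl.comul_eq_tmul_self, mulTensor_tmul]
    change convRep κ (g κ ^ (l : ℕ)) * convMul K B φ * convRep κ (HopfAlgebra.antipode K _) = _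
    rw [convRep_g_pow] at e ⊢
    rw [convG_pow_mul_convMul, mul_assoc, e, mul_one]
  | hx l =>
    have hl := isGroupLikeElem_g_pow κ l
    have hl' := isGroupLikeElem_g_pow κ (l + 1)
    have hξ := comul_g_pow_mul_x κ l
    have e := congrArg (convRep κ (B := B)) hl'.mul_antipode_cancel
    have e' := congrArg (convRep κ (B := B)) (HopfAlgebra.mul_antipode_lTensor_comul_apply
      (R := K) (g κ ^ (l : ℕ) * x κ))
    rw [Hpar.counit_of_skewPrimitive hl hl' hξ, hξ, map_add, map_add, map_add,
      LinearMap.lTensor_tmul, LinearMap.lTensor_tmul, LinearMap.mul'_apply, LinearMap.mul'_apply,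
      map_mul, map_mul _ (g κ ^ (l : ℕ)) (HopfAlgebra.antipode K _), map_zero, map_zero,
      convRep_g_pow_mul_x, convRep_g_pow] at e'
    rw [map_mul, map_one, convRep_g_pow] at e
    rw [conjMap, LinearMap.comp_apply, hξ, map_add, mulTensor_tmul, mulTensor_tmul]
    change convRep κ (g κ ^ (l : ℕ) * x κ) * convMul K B φ *
        convRep κ (HopfAlgebra.antipode K _) +
      convRep κ (g κ ^ (l : ℕ)) * convMul K B φ * convRep κ (HopfAlgebra.antipode K _) = _
    rw [convRep_g_pow_mul_x, convRep_g_pow, mul_assoc _ (convX K κ B), convX_mul_convMul, mul_add,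
      ← mul_assoc _ _ (convG K B), ← mul_assoc _ _ (convX K κ B), convG_pow_mul_convMul,
      convG_pow_mul_convMul, mul_assoc _ _ (convG K B), ← pow_succ, add_mul,
      mul_assoc _ _ (convRep κ _), e, mul_one, add_assoc]
    simp only [mul_assoc] at e' ⊢
    rw [← mul_add, e', mul_zero, add_zero]
    rfl
  | hadd a b ha hb => simp only [map_add, ha, hb, LinearMap.add_apply]
  | hsmul c a ha => simp only [map_smul, ha, LinearMap.smul_apply]

/-- The element of `Conv B` that sends `gⁱ` to `χ i` and `gⁱ x` to `(-1)ⁱ (χ (i + 1) - χ i) z`. -/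
def convIdem (χ : Fin 4 → B) (z : B) : Conv B :=
  (χ, fun i => (-1) ^ (i : ℕ) * (χ (i + 1) - χ i) * z)

theorem convRep_g_pow_convIdem (χ : Fin 4 → B) (z : B) (l : Fin 4) :
    convRep κ (g κ ^ (l : ℕ)) (convIdem χ z) = (fun i : Fin 4 => χ (i + l), fun i : Fin 4 =>
      (-1) ^ (i : ℕ) * (χ (i + l + 1) - χ (i + l)) * z) := by
  have hs : (-1 : B) ^ (l : ℕ) * (-1) ^ (l : ℕ) = 1 := by rw [← mul_pow]; simp
  rw [convRep_g_pow, convG_pow_apply]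
  refine Prod.ext rfl (funext fun i => ?_)
  simp only [convIdem, neg_one_pow_val_add i l]
  linear_combination (-1) ^ (i : ℕ) * (χ (i + l + 1) - χ (i + l)) * z * hs

theorem convRep_g_pow_mul_x_convIdem (χ : Fin 4 → B) (z : B) (l : Fin 4) :
    convRep κ (g κ ^ (l : ℕ) * x κ) (convIdem χ z) =
      (fun i : Fin 4 => (-1) ^ (i : ℕ) * (-1) ^ (l : ℕ) * (χ (i + l + 1) - χ (i + l)) * z,
        fun i => (-1) ^ (l : ℕ) * (algebraMap K B κ * (χ (i + l + 2) - χ (i + l)))) := by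
  rw [convRep_g_pow_mul_x, Module.End.mul_apply, convG_pow_apply, convX_apply]
  refine Prod.ext (funext fun i => ?_) (funext fun i => ?_)
  · simp only [convIdem, neg_one_pow_val_add i l]
  · simp only [convIdem, Algebra.smul_def]

variable {χ : Fin 4 → B} {z : B}

theorem isIdempotentElem_convMul_convIdem (hχ : ∀ i, χ i * χ i = χ i) :
    IsIdempotentElem (convMul K B (convIdem χ z)) := by
  refine LinearMap.ext fun m => Prod.ext (funext fun i => ?_) (funext fun i => ?_)
  · simp only [Module.End.mul_apply, convMul_apply, convIdem]
    linear_combination m.1 i * hχ i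
  · simp only [Module.End.mul_apply, convMul_apply, convIdem]
    linear_combination m.2 i * hχ i +
      (-1) ^ (i : ℕ) * z * m.1 (i + 1) * (hχ (i + 1) - hχ i)

/-- Multiplication by `φ = convIdem χ z` commutes with multiplication by `h · φ`. For `h = gˡ` this
holds for every `z`; the condition on `z` is what is needed for `h = gˡ x`. -/
theorem convMul_convIdem_commute (κ : K)
    (hz : ∀ i, (z ^ 2 + algebraMap K B κ) * (χ (i + 2) - χ i) = 0) (h : H κ) :
    convMul K B (convIdem χ z) * conjMap (convRep κ) (convMul K B (convIdem χ z)) h =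
      conjMap (convRep κ) (convMul K B (convIdem χ z)) h * convMul K B (convIdem χ z) := by
  rw [conjMap_convMul]
  induction h using induction_basis with
  | hg l =>
    refine convMul_commute (K := K) fun i => ?_
    rw [convRep_g_pow_convIdem]
    simp only [convIdem, add_right_comm i 1 l]
    ring
  | hx l =>
    refine convMul_commute (K := K) fun i => ?_
    have e : i + l + 1 + 1 = i + l + 2 := by rw [add_assoc]; rfl
    rw [convRep_g_pow_mul_x_convIdem]
    simp only [convIdem, add_right_comm i 1 l, neg_one_pow_val_add i 1, e, Fin.val_one, pow_one]
    have hs : (-1 : B) ^ (i : ℕ) * (-1) ^ (i : ℕ) = 1 := by rw [← mul_pow]; simp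
    linear_combination (-(-1 : B) ^ (l : ℕ) * (χ (i + 1) - χ i)) * hz (i + l) +
      z ^ 2 * (-1) ^ (l : ℕ) * (χ (i + l + 2) - χ (i + l)) * (χ i - χ (i + 1)) * hs
  | hadd a b ha hb => simp only [map_add, LinearMap.add_apply, mul_add, add_mul, ha, hb]
  | hsmul c a ha =>
    simp only [map_smul, LinearMap.smul_apply, mul_smul_comm, smul_mul_assoc, ha]

/-- Every family `χ` of four idempotents with `χ 0 = 1` in a commutative algebra `B`, together with
`z ∈ B` such that `z² + κ` annihilates all the `χ (i + 2) - χ i`, gives an algebra map `A → B`. -/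
theorem exists_algHom (κ : K) (h0 : χ 0 = 1) (hχ : ∀ i, χ i * χ i = χ i)
    (hz : ∀ i, (z ^ 2 + algebraMap K B κ) * (χ (i + 2) - χ i) = 0) :
    ∃ Φ : A κ →ₐ[K] B, (∀ l, Φ (epsG κ l) = χ l) ∧
      ∀ l, Φ (epsX κ l) = (-1) ^ (l : ℕ) * (χ (l + 1) - χ l) * z := by
  have hT := isIdempotentElem_convMul_convIdem (K := K) (z := z) hχ
  have hcomm := convMul_convIdem_commute κ hz
  let Θ : A κ →ₐ[K] hT.Corner := (partialRep hT hcomm).comp (Apar K (H κ)).val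
  let val : A κ → Module.End K (Conv B) := fun a => cornerVal (K := K) hT (Θ a)
  have val_eps (h : H κ) : val (Apar.eps K (H κ) h) =
      convMul K B (convIdem χ z) * convMul K B (convRep κ h (convIdem χ z)) := by
    rw [← conjMap_convMul]
    exact cornerVal_partialRep_eps hT hcomm h
  have val_algebraMap (c : K) : val (algebraMap K (A κ) c) = c • convMul K B (convIdem χ z) := by
    simp only [val, AlgHom.commutes]
    exact cornerVal_algebraMap hT c
  have val_mul (a b : A κ) : val (a * b) = val a * val b := by
    simp only [val, map_mul, cornerVal_mul]
  have val_add (a b : A κ) : val (a + b) = val a + val b := by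
    simp only [val, map_add]
  -- evaluation at `1 ∈ H` is multiplicative on the operators in question, since they are
  -- multiplications in the convolution algebra and `1` is group-like
  have key (a : A κ) : ∃ b : B, ∀ m : Conv B, (val a m).1 0 = b * m.1 0 := by
    induction a using Apar.induction with
    | hc c =>
      refine ⟨algebraMap K B c, fun m => ?_⟩
      rw [val_algebraMap, ← Algebra.smul_def]
      simp [convMul_apply, convIdem, h0]
    | heps h =>
      refine ⟨(convRep κ h (convIdem χ z)).1 0, fun m => ?_⟩
      rw [val_eps]
      simp [convMul_apply, convIdem, h0]
    | hmul a b ha hb =>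
      obtain ⟨a', ha⟩ := ha
      obtain ⟨b', hb⟩ := hb
      exact ⟨a' * b', fun m => by rw [val_mul, Module.End.mul_apply, ha, hb, mul_assoc]⟩
    | hadd a b ha hb =>
      obtain ⟨a', ha⟩ := ha
      obtain ⟨b', hb⟩ := hb
      exact ⟨a' + b', fun m => by rw [val_add, add_mul, ← ha, ← hb]; rfl⟩
  let v : Conv B := (fun _ => 1, 0)
  let Φ : A κ →ₐ[K] B :=
    { toFun := fun a => (val a v).1 0
      map_one' := by
        rw [← map_one (algebraMap K (A κ)), val_algebraMap]
        simp [convMul_apply, convIdem, h0, v]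
      map_mul' := fun a b => by
        obtain ⟨a', ha⟩ := key a
        rw [val_mul, Module.End.mul_apply, ha, ha v]
        simp [v]
      map_zero' := by
        rw [← map_zero (algebraMap K (A κ)), val_algebraMap]
        simp
      map_add' := fun a b => by rw [val_add]; rfl
      commutes' := fun c => by
        rw [val_algebraMap]
        simp [convMul_apply, convIdem, h0, v, Algebra.algebraMap_eq_smul_one] }
  have hΦ (h : H κ) : Φ (Apar.eps K (H κ) h) = (convRep κ h (convIdem χ z)).1 0 := by
    change (val _ v).1 0 = _
    rw [val_eps]
    simp [convMul_apply, convIdem, h0, v]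
  refine ⟨Φ, fun l => ?_, fun l => ?_⟩
  · rw [epsG, hΦ, convRep_g_pow_convIdem]
    simp
  · rw [epsX, hΦ, convRep_g_pow_mul_x_convIdem]
    simp

end Convolution

end RankOne

/-! ### The summands -/

namespace RankOne

variable {K : Type*} [Field K] {κ : K}

theorem isIdempotentElem_P (κ : K) (X : Finset (Fin 4)) : IsIdempotentElem (P κ X) := P_mul_self X

/-- The projection `a ↦ P_X a` from `A` to the summand `P_X A`. -/
def toCorner (κ : K) (X : Finset (Fin 4)) : A κ →ₐ[K] (isIdempotentElem_P κ X).Corner where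
  toFun a := ⟨P κ X * a, a, by
    change P κ X * a * P κ X = _
    rw [mul_assoc, ← P_comm, ← mul_assoc, P_mul_self]⟩
  map_one' := Subtype.ext (mul_one _)
  map_mul' a b := Subtype.ext (P_mul_mul X a b)
  map_zero' := Subtype.ext (mul_zero _)
  map_add' a b := Subtype.ext (mul_add _ a b)
  commutes' c := Subtype.ext (by
    change P κ X * algebraMap K (A κ) c = c • P κ X
    rw [Algebra.algebraMap_eq_smul_one, mul_smul_comm, mul_one])

theorem cornerVal_toCorner (X : Finset (Fin 4)) (a : A κ) :
    cornerVal (K := K) (isIdempotentElem_P κ X) (toCorner κ X a) = P κ X * a := rfl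

theorem toCorner_surjective (X : Finset (Fin 4)) : Function.Surjective (toCorner κ X) := by
  rintro ⟨_, a, rfl⟩
  refine ⟨a, Subtype.ext ?_⟩
  change P κ X * a = P κ X * a * P κ X
  rw [mul_assoc, ← P_comm, ← mul_assoc, P_mul_self]

theorem toCorner_epsG (X : Finset (Fin 4)) (l : Fin 4) :
    toCorner κ X (epsG κ l) = algebraMap K _ (ind K X l) :=
  Subtype.ext (P_mul_epsG X l)

/-- The summand `P_X A` is generated by the elements `P_X ε_{gˡ x}`. -/
theorem corner_subalgebra_eq_top (X : Finset (Fin 4))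
    (S : Subalgebra K (isIdempotentElem_P κ X).Corner)
    (hS : ∀ l, toCorner κ X (epsX κ l) ∈ S) : S = ⊤ := by
  rw [eq_top_iff]
  intro b _
  obtain ⟨a, rfl⟩ := toCorner_surjective X b
  induction a using Apar.induction with
  | hc c => rw [AlgHom.commutes]; exact S.algebraMap_mem c
  | heps h =>
    induction h using induction_basis with
    | hg l =>
      change toCorner κ X (epsG κ l) ∈ S
      rw [toCorner_epsG]; exact S.algebraMap_mem _
    | hx l => exact hS l
    | hadd a b ha hb => rw [Apar.eps_add, map_add]; exact add_mem (ha trivial) (hb trivial)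
    | hsmul c a ha => rw [Apar.eps_smul, map_smul]; exact S.smul_mem (ha trivial) c
  | hmul a b ha hb => rw [map_mul]; exact mul_mem (ha trivial) (hb trivial)
  | hadd a b ha hb => rw [map_add]; exact add_mem (ha trivial) (hb trivial)

theorem aeval_toCorner_surjective (X : Finset (Fin 4)) (l : Fin 4)
    (h : ∀ m, ∃ c : K, P κ X * epsX κ m = c • (P κ X * epsX κ l)) :
    Function.Surjective (Polynomial.aeval (R := K) (toCorner κ X (epsX κ l))) := by
  rw [← AlgHom.range_eq_top]
  refine corner_subalgebra_eq_top X _ fun m => ?_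
  obtain ⟨c, hc⟩ := h m
  have e : toCorner κ X (epsX κ m) = c • toCorner κ X (epsX κ l) := Subtype.ext hc
  rw [e]
  exact Subalgebra.smul_mem _ ((AlgHom.mem_range _).mpr ⟨Polynomial.X, Polynomial.aeval_X _⟩) c

theorem algHom_P_eq_one {B : Type*} [CommRing B] [Algebra K B] (Φ : A κ →ₐ[K] B)
    (X : Finset (Fin 4)) (hΦ : ∀ l, Φ (epsG κ l) = algebraMap K B (ind K X l)) :
    Φ (P κ X) = 1 := by
  rw [P, map_mul, map_list_prod, map_list_prod, List.prod_eq_one, List.prod_eq_one, one_mul]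
  · simp only [List.mem_map, List.mem_filter, decide_eq_true_eq]
    rintro _ ⟨_, ⟨l, ⟨_, hl⟩, rfl⟩, rfl⟩
    simp [hΦ, ind, hl]
  · simp only [List.mem_map, List.mem_filter, decide_eq_true_eq]
    rintro _ ⟨_, ⟨l, ⟨_, hl⟩, rfl⟩, rfl⟩
    simp [hΦ, ind, hl]

theorem ind_mul_self (X : Finset (Fin 4)) (l : Fin 4) : ind K X l * ind K X l = ind K X l := by
  unfold ind; split_ifs <;> simp

/-- An algebra map `A → B` that is the projection to the summand `P_X A`, followed by a map that
sends `P_X ε_{gˡ x}` to `b`. -/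
theorem exists_algHom_P {B : Type*} [CommRing B] [Algebra K B] {X : Finset (Fin 4)} (hX : 0 ∈ X)
    {l : Fin 4} (hl : jump K X l ≠ 0) (b : B)
    (hb : ∀ i, (b ^ 2 + algebraMap K B κ) * algebraMap K B (ind K X (i + 2) - ind K X i) = 0) :
    ∃ Φ : A κ →ₐ[K] B, Φ (P κ X) = 1 ∧ Φ (epsX κ l) = b := by
  have hs : (algebraMap K B ((-1) ^ (l : ℕ) * jump K X l)) ^ 2 = 1 := by
    rw [← map_pow, mul_pow, pow_two (jump K X l), jump_mul_self X l hl, ← pow_mul, mul_comm _ 2,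
      pow_mul]
    simp
  obtain ⟨Φ, h1, h2⟩ := exists_algHom κ (χ := fun i => algebraMap K B (ind K X i))
    (z := algebraMap K B ((-1) ^ (l : ℕ) * jump K X l) * b) (by simp [ind, hX])
    (fun i => by rw [← map_mul, ind_mul_self])
    (fun i => by rw [← map_sub, mul_pow, hs, one_mul]; exact hb i)
  refine ⟨Φ, algHom_P_eq_one Φ X h1, ?_⟩
  rw [h2, ← map_sub]
  change (-1) ^ (l : ℕ) * algebraMap K B (jump K X l) * _ = b
  rw [map_mul, map_pow, map_neg, map_one] at hs ⊢
  linear_combination b * hs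

theorem algHom_aeval_eq_zero {B : Type*} [CommRing B] [Algebra K B] {X : Finset (Fin 4)}
    (Φ : A κ →ₐ[K] B) (hΦ : Φ (P κ X) = 1) (a : A κ) (p : K[X])
    (hp : Polynomial.aeval (toCorner κ X a) p = 0) : Polynomial.aeval (Φ a) p = 0 := by
  rw [Polynomial.aeval_algHom_apply] at hp ⊢
  have h := congrArg (cornerVal (K := K) (isIdempotentElem_P κ X)) hp
  rw [cornerVal_toCorner, map_zero] at h
  rw [← one_mul (Φ _), ← hΦ, ← map_mul, h, map_zero]

theorem exists_smul_of_jump_ne_zero (X : Finset (Fin 4)) (l : Fin 4) (hl : jump K X l ≠ 0)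
    (m : Fin 4) : ∃ c : K, P κ X * epsX κ m = c • (P κ X * epsX κ l) := by
  have h := P_mul_epsX (κ := κ) X l (m - l) hl
  rw [add_sub_cancel] at h
  exact ⟨_, h⟩

/-- A summand `P_X A` for which the indicator function of `X` does not have period `2`. -/
theorem exists_quotient_algEquiv_corner {X : Finset (Fin 4)} (hX : 0 ∈ X) (l m : Fin 4)
    (hl : jump K X l ≠ 0) (hm : ind K X (l + m + 2) - ind K X (l + m) ≠ 0) :
    ∃ (e : IsIdempotentElem (P κ X))
      (φ : (K[X] ⧸ Ideal.span {Polynomial.X ^ 2 + Polynomial.C κ}) ≃ₐ[K] e.Corner),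
      (φ (Ideal.Quotient.mk _ Polynomial.X)).1 = P κ X * epsX κ l := by
  let f : K[X] := Polynomial.X ^ 2 + Polynomial.C κ
  let ψ := Polynomial.aeval (R := K) (toCorner κ X (epsX κ l))
  have hψ : ∀ p ∈ Ideal.span {f}, ψ p = 0 := by
    intro p hp
    rw [← RingHom.mem_ker]
    refine (Ideal.span_singleton_le_iff_mem _).mpr ?_ hp
    rw [RingHom.mem_ker, map_add, map_pow, Polynomial.aeval_X, Polynomial.aeval_C, ← map_pow]
    refine Subtype.ext ?_
    change P κ X * epsX κ l ^ 2 + κ • P κ X = 0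
    rw [P_mul_epsX_sq X l m hl hm, neg_add_cancel]
  obtain ⟨Φ, h1, h2⟩ := exists_algHom_P (κ := κ) hX hl (Ideal.Quotient.mk (Ideal.span {f})
    Polynomial.X) (fun i => by
      have h : Ideal.Quotient.mk (Ideal.span {f}) f = 0 :=
        Ideal.Quotient.eq_zero_iff_mem.mpr (Ideal.mem_span_singleton_self f)
      have h' : Ideal.Quotient.mk (Ideal.span {f}) Polynomial.X ^ 2 +
        algebraMap K (K[X] ⧸ Ideal.span {f}) κ = 0 := by rw [← h]; rfl
      rw [h', zero_mul])
  let φ := Ideal.Quotient.liftₐ (Ideal.span {f}) ψ hψ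
  have hφ : Function.Bijective φ := by
    constructor
    · rw [injective_iff_map_eq_zero]
      intro q hq
      obtain ⟨p, rfl⟩ := Ideal.Quotient.mk_surjective q
      have hp := algHom_aeval_eq_zero Φ h1 (epsX κ l) p hq
      rw [h2] at hp
      rw [← hp]
      exact ((Polynomial.aeval_algHom_apply (Ideal.Quotient.mkₐ K (Ideal.span {f}))
        Polynomial.X p).trans (by rw [Polynomial.aeval_X_left_apply]; rfl)).symm
    · intro b
      obtain ⟨p, hp⟩ := aeval_toCorner_surjective X l (exists_smul_of_jump_ne_zero X l hl) b
      exact ⟨Ideal.Quotient.mk _ p, hp⟩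
  refine ⟨isIdempotentElem_P κ X, AlgEquiv.ofBijective φ hφ, ?_⟩
  have h : φ (Ideal.Quotient.mk _ Polynomial.X) = toCorner κ X (epsX κ l) :=
    Polynomial.aeval_X _
  exact congrArg (cornerVal (K := K) (isIdempotentElem_P κ X)) h

/-- A summand `P_X A` for which the indicator function of `X` has period `2` but is not constant. -/
theorem exists_polynomial_algEquiv_corner {X : Finset (Fin 4)} (hX : 0 ∈ X) (l : Fin 4)
    (hl : jump K X l ≠ 0) (hper : ∀ i, i + 2 ∈ X ↔ i ∈ X) :
    ∃ (e : IsIdempotentElem (P κ X)) (φ : K[X] ≃ₐ[K] e.Corner),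
      (φ Polynomial.X).1 = P κ X * epsX κ l := by
  obtain ⟨Φ, h1, h2⟩ := exists_algHom_P (κ := κ) hX hl (Polynomial.X : K[X])
    (fun i => by rw [ind, ind, if_congr (hper i) rfl rfl, sub_self, map_zero, mul_zero])
  let ψ := Polynomial.aeval (R := K) (toCorner κ X (epsX κ l))
  have hψ : Function.Bijective ψ := by
    refine ⟨(injective_iff_map_eq_zero _).mpr fun p hp => ?_,
      aeval_toCorner_surjective X l (exists_smul_of_jump_ne_zero X l hl)⟩
    have hp := algHom_aeval_eq_zero Φ h1 (epsX κ l) p hp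
    rwa [h2, Polynomial.aeval_X_left_apply] at hp
  refine ⟨isIdempotentElem_P κ X, AlgEquiv.ofBijective ψ hψ, ?_⟩
  have h : ψ Polynomial.X = toCorner κ X (epsX κ l) := Polynomial.aeval_X _
  exact congrArg (cornerVal (K := K) (isIdempotentElem_P κ X)) h

/-- The summand `P_X A` for `X = G`: it is generated by scalars, and not zero because there is an
algebra map `A → K` with `ε_{gˡ} ↦ 1`. -/
theorem exists_field_algEquiv_corner {X : Finset (Fin 4)} (hX : ∀ l, l ∈ X) :
    ∃ e : IsIdempotentElem (P κ X), Nonempty (K ≃ₐ[K] e.Corner) := by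
  refine ⟨isIdempotentElem_P κ X, ⟨AlgEquiv.ofBijective (Algebra.ofId K _) ⟨?_, ?_⟩⟩⟩
  · rw [injective_iff_map_eq_zero]
    intro c hc
    obtain ⟨Φ, h, -⟩ := exists_algHom κ (χ := fun _ => (1 : K)) (z := 0) rfl (by simp) (by simp)
    have h1 := algHom_P_eq_one Φ X (fun l => by simp [h, ind, hX])
    have h2 := congrArg (cornerVal (K := K) (isIdempotentElem_P κ X)) hc
    rw [map_zero, Algebra.ofId_apply, cornerVal_algebraMap] at h2
    have h3 := congrArg Φ h2
    rw [map_smul, h1, map_zero] at h3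
    simpa using h3
  · rw [← AlgHom.range_eq_top]
    refine corner_subalgebra_eq_top X _ fun l => ?_
    have e : toCorner κ X (epsX κ l) = 0 :=
      Subtype.ext (P_mul_epsX_eq_zero X l (hX _) (hX _))
    rw [e]
    exact zero_mem _

end RankOne

open RankOne (A epsG epsX P P₁ δ)

theorem mainTheorem11 (K : Type*) [Field K] (κ : K) (f : K[X])
    -- `x² = 0` and `f = X²` (nilpotent case), or `x² = g² - 1` and `f = X² + 1`
    (hκ : (κ = 0 ∧ f = Polynomial.X ^ 2) ∨ (κ = 1 ∧ f = Polynomial.X ^ 2 + 1)) :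
    -- a complete family of mutually orthogonal central idempotents
    CompleteOrthogonalIdempotents (fun Y : P₁ => P κ Y.1) ∧
    (∀ Y : P₁, P κ Y.1 ∈ Subalgebra.center K (A κ)) ∧
    -- the relations
    (∀ l, P κ {0} * epsG κ l = (δ K l 0) • P κ {0}) ∧
    (∀ l, P κ {0} * epsX κ l = (δ K l 0 + δ K l 3) • (P κ {0} * epsX κ 0)) ∧
    P κ {0} * epsX κ 0 ^ 2 = -(κ • P κ {0}) ∧
    (∀ l, P κ {0, 1} * epsG κ l = (δ K l 0 + δ K l 1) • P κ {0, 1}) ∧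
    (∀ l, P κ {0, 1} * epsX κ l = (δ K l 1 - δ K l 3) • (P κ {0, 1} * epsX κ 1)) ∧
    P κ {0, 1} * epsX κ 1 ^ 2 = -(κ • P κ {0, 1}) ∧
    (∀ l, P κ {0, 3} * epsG κ l = (δ K l 0 + δ K l 3) • P κ {0, 3}) ∧
    (∀ l, P κ {0, 3} * epsX κ l = (δ K l 0 - δ K l 2) • (P κ {0, 3} * epsX κ 0)) ∧
    P κ {0, 3} * epsX κ 0 ^ 2 = -(κ • P κ {0, 3}) ∧
    (∀ l, P κ {0, 2} * epsG κ l = (δ K l 0 + δ K l 2) • P κ {0, 2}) ∧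
    (∀ l, P κ {0, 2} * epsX κ l = P κ {0, 2} * epsX κ 0) ∧
    (∀ l, P κ {0, 1, 2} * epsG κ l = (δ K l 0 + δ K l 1 + δ K l 2) • P κ {0, 1, 2}) ∧
    (∀ l, P κ {0, 1, 2} * epsX κ l = (δ K l 2 + δ K l 3) • (P κ {0, 1, 2} * epsX κ 2)) ∧
    P κ {0, 1, 2} * epsX κ 2 ^ 2 = -(κ • P κ {0, 1, 2}) ∧
    (∀ l, P κ {0, 1, 3} * epsG κ l = (δ K l 0 + δ K l 1 + δ K l 3) • P κ {0, 1, 3}) ∧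
    (∀ l, P κ {0, 1, 3} * epsX κ l = (δ K l 1 + δ K l 2) • (P κ {0, 1, 3} * epsX κ 1)) ∧
    P κ {0, 1, 3} * epsX κ 1 ^ 2 = -(κ • P κ {0, 1, 3}) ∧
    (∀ l, P κ {0, 2, 3} * epsG κ l = (δ K l 0 + δ K l 2 + δ K l 3) • P κ {0, 2, 3}) ∧
    (∀ l, P κ {0, 2, 3} * epsX κ l = (δ K l 0 + δ K l 1) • (P κ {0, 2, 3} * epsX κ 0)) ∧
    P κ {0, 2, 3} * epsX κ 0 ^ 2 = -(κ • P κ {0, 2, 3}) ∧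
    (∀ l, P κ {0, 1, 2, 3} * epsG κ l = P κ {0, 1, 2, 3}) ∧
    (∀ l, P κ {0, 1, 2, 3} * epsX κ l = 0) ∧
    -- the summands `P_X A`
    (∃ (e : IsIdempotentElem (P κ {0})) (φ : (K[X] ⧸ Ideal.span {f}) ≃ₐ[K] e.Corner),
      (φ (Ideal.Quotient.mk _ Polynomial.X)).1 = P κ {0} * epsX κ 0) ∧
    (∃ (e : IsIdempotentElem (P κ {0, 1})) (φ : (K[X] ⧸ Ideal.span {f}) ≃ₐ[K] e.Corner),
      (φ (Ideal.Quotient.mk _ Polynomial.X)).1 = P κ {0, 1} * epsX κ 1) ∧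
    (∃ (e : IsIdempotentElem (P κ {0, 3})) (φ : (K[X] ⧸ Ideal.span {f}) ≃ₐ[K] e.Corner),
      (φ (Ideal.Quotient.mk _ Polynomial.X)).1 = P κ {0, 3} * epsX κ 0) ∧
    (∃ (e : IsIdempotentElem (P κ {0, 2})) (φ : K[X] ≃ₐ[K] e.Corner),
      (φ Polynomial.X).1 = P κ {0, 2} * epsX κ 0) ∧
    (∃ (e : IsIdempotentElem (P κ {0, 1, 2})) (φ : (K[X] ⧸ Ideal.span {f}) ≃ₐ[K] e.Corner),
      (φ (Ideal.Quotient.mk _ Polynomial.X)).1 = P κ {0, 1, 2} * epsX κ 2) ∧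
    (∃ (e : IsIdempotentElem (P κ {0, 1, 3})) (φ : (K[X] ⧸ Ideal.span {f}) ≃ₐ[K] e.Corner),
      (φ (Ideal.Quotient.mk _ Polynomial.X)).1 = P κ {0, 1, 3} * epsX κ 1) ∧
    (∃ (e : IsIdempotentElem (P κ {0, 2, 3})) (φ : (K[X] ⧸ Ideal.span {f}) ≃ₐ[K] e.Corner),
      (φ (Ideal.Quotient.mk _ Polynomial.X)).1 = P κ {0, 2, 3} * epsX κ 0) ∧
    (∃ e : IsIdempotentElem (P κ {0, 1, 2, 3}), Nonempty (K ≃ₐ[K] e.Corner)) := by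
  -- the two cases are treated at once: `f = X² + κ` in both of them
  have hf : f = Polynomial.X ^ 2 + Polynomial.C κ := by
    rcases hκ with ⟨rfl, rfl⟩ | ⟨rfl, rfl⟩ <;> simp
  subst hf
  have hG (X : Finset (Fin 4)) (l : Fin 4) (c : K) (h : RankOne.ind K X l = c) :
      P κ X * epsG κ l = c • P κ X := by rw [RankOne.P_mul_epsG, h]
  have hX (X : Finset (Fin 4)) (l m : Fin 4) (c : K) (hl : RankOne.jump K X l ≠ 0)
      (h : (-1) ^ ((m - l : Fin 4) : ℕ) * RankOne.jump K X l * RankOne.jump K X m = c) :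
      P κ X * epsX κ m = c • (P κ X * epsX κ l) := by
    have h' := RankOne.P_mul_epsX (κ := κ) X l (m - l) hl
    rwa [add_sub_cancel, h] at h'
  refine ⟨RankOne.completeOrthogonalIdempotents_P, fun Y => RankOne.P_mem_center Y.1, ?_⟩
  refine ⟨fun l => hG _ _ _ ?_, fun l => hX _ _ _ _ ?_ ?_, RankOne.P_mul_epsX_sq _ _ 0 ?_ ?_,
    fun l => hG _ _ _ ?_, fun l => hX _ _ _ _ ?_ ?_, RankOne.P_mul_epsX_sq _ _ 0 ?_ ?_,
    fun l => hG _ _ _ ?_, fun l => hX _ _ _ _ ?_ ?_, RankOne.P_mul_epsX_sq _ _ 0 ?_ ?_,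
    fun l => hG _ _ _ ?_, fun l => (hX _ _ _ 1 ?_ ?_).trans (one_smul K _),
    fun l => hG _ _ _ ?_, fun l => hX _ _ _ _ ?_ ?_, RankOne.P_mul_epsX_sq _ _ 1 ?_ ?_,
    fun l => hG _ _ _ ?_, fun l => hX _ _ _ _ ?_ ?_, RankOne.P_mul_epsX_sq _ _ 1 ?_ ?_,
    fun l => hG _ _ _ ?_, fun l => hX _ _ _ _ ?_ ?_, RankOne.P_mul_epsX_sq _ _ 1 ?_ ?_,
    fun l => (hG _ _ 1 ?_).trans (one_smul K _), fun l => RankOne.P_mul_epsX_eq_zero _ _ ?_ ?_,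
    RankOne.exists_quotient_algEquiv_corner ?_ _ 0 ?_ ?_,
    RankOne.exists_quotient_algEquiv_corner ?_ _ 0 ?_ ?_,
    RankOne.exists_quotient_algEquiv_corner ?_ _ 0 ?_ ?_,
    RankOne.exists_polynomial_algEquiv_corner ?_ _ ?_ ?_,
    RankOne.exists_quotient_algEquiv_corner ?_ _ 1 ?_ ?_,
    RankOne.exists_quotient_algEquiv_corner ?_ _ 1 ?_ ?_,
    RankOne.exists_quotient_algEquiv_corner ?_ _ 1 ?_ ?_,
    RankOne.exists_field_algEquiv_corner ?_⟩
  -- what remains is the evaluation of the indicator functions of the eight sets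
  all_goals first
    | decide
    | simp [RankOne.jump, RankOne.ind]; done
    | fin_cases l <;> simp [RankOne.jump, RankOne.ind, δ, pow_succ]
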